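/- **Proposition.** Let $(M,g)$ be a compact smooth Riemannian manifold without boundary of dimension $n\ge 3$, let $k\ge 1$ be an integer, with $k\le n/2$ if $n$ is even, and let $\Delta_g=-\mathrm{div}_g\nabla$. Let $P_g:C^\infty(M)\to C^\infty(M)$ be a linear differential operator with smooth coefficients such that - $P_g=\Delta_g^k+$ terms of order less than $2k$, and - $P_g$ is self-adjoint for the $L^2$ scalar product: $\int_M u\,P_gv\,dv_g=\int_M v\,P_gu\,dv_g$ for all $u,v\in C^\infty(M)$ (for instance, the GJMS operator of order $2k$ of $g$). Let $H_k^2(M)$ be the completion of $C^\infty(M)$ for the norm $\|u\|_{H_k^2}=\sum_{l=0}^k\|\nabla^l u\|_2$. Then the bilinear form $(u,v)\mapsto\int_M u\,P_gv\,dv_g$ on $C^\infty(M)$ extends in a unique way to a continuous bilinear form on $H_k^2(M)\times H_k^2(M)$, which is symmetric and is still written $\int_M u\,P_gv\,dv_g$. Assume moreover that $P_g$ is coercive: there is $c>0$ such that $$\int_M u\,P_gu\,dv_g\ \ge\ c\,\|u\|_2^2\qquad\text{for all }u\in H_k^2(M).$$ Then $\|u\|_{P_g}:=\left(\int_M u\,P_gu\,dv_g\right)^{1/2}$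 is a norm on $H_k^2(M)$, and it is equivalent to $\|\cdot\|_{H_k^2}$: there are $C_1,C_2>0$ such that $C_1\|u\|_{H_k^2}\le\|u\|_{P_g}\le C_2\|u\|_{H_k^2}$ for all $u\in H_k^2(M)$. -/

import Mathlib

open scoped Manifold ContDiff

/-- The space `ℝⁿ` with its Euclidean norm. -/
abbrev EuclSp (n : ℕ) : Type := EuclideanSpace ℝ (Fin n)

/-- Smooth Riemannian metrics on the manifold `M`. -/
abbrev RiemMetric (n : ℕ) (M : Type*) [TopologicalSpace M] [ChartedSpace (EuclSp n) M]
    [IsManifold (𝓡 n) ∞ M] : Type _ :=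
  Bundle.ContMDiffRiemannianMetric (𝓡 n) ∞ (EuclSp n) (fun x : M => TangentSpace (𝓡 n) x)

/-- The space `C^∞(M)` of smooth real functions. -/
abbrev SmoothFun (n : ℕ) (M : Type*) [TopologicalSpace M] [ChartedSpace (EuclSp n) M] : Type _ :=
  C^∞⟮𝓡 n, M; ℝ⟯

namespace RiemSobolev

noncomputable section

attribute [local instance 2000] chartedSpaceSelf

variable {n : ℕ} {M : Type*} [TopologicalSpace M] [ChartedSpace (EuclSp n) M]

section LocalExpressions

/-- The partial derivative `∂_i f` of a function on `ℝⁿ`. -/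
def pderiv (i : Fin n) (f : EuclSp n → ℝ) (y : EuclSp n) : ℝ :=
  fderiv ℝ f y (EuclideanSpace.single i 1)

/-- The coordinate vector field `∂/∂x^i` of the chart `φ`, at the point with coordinates `y`. -/
def coordVec (φ : OpenPartialHomeomorph M (EuclSp n)) (i : Fin n) (y : EuclSp n) :
    TangentSpace (𝓡 n) (φ.symm y) :=
  mfderiv (𝓡 n) (𝓡 n) φ.symm y (EuclideanSpace.single i (1 : ℝ) : EuclSp n)

variable [IsManifold (𝓡 n) ∞ M] (g : RiemMetric n M) (φ : OpenPartialHomeomorph M (EuclSp n))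

/-- The matrix `(g_{ij})` of the metric in the chart `φ`. -/
def gram (y : EuclSp n) : Matrix (Fin n) (Fin n) ℝ :=
  Matrix.of fun i j => g.inner (φ.symm y) (coordVec φ i y) (coordVec φ j y)

/-- The inverse matrix `(g^{ij})`. -/
def gramInv (y : EuclSp n) : Matrix (Fin n) (Fin n) ℝ := (gram g φ y)⁻¹

/-- The density `√(det g)` of the Riemannian volume in the chart `φ`. -/
def volDensity (y : EuclSp n) : ℝ := √((gram g φ y).det)

/-- The Christoffel symbol `Γ^m_{ij}` of the Levi-Civita connection in the chart `φ`. -/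
def christoffel (m i j : Fin n) (y : EuclSp n) : ℝ :=
  (1 / 2) * ∑ l, gramInv g φ y m l *
    (pderiv i (fun z => gram g φ z j l) y + pderiv j (fun z => gram g φ z i l) y
      - pderiv l (fun z => gram g φ z i j) y)

/-- The components `(∇^l f)_{i_1 ⋯ i_l}` in the chart `φ` of the `l`-th iterated covariant
derivative of a function whose expression in the chart is `f`:
`(∇^{l+1} f)_{i_0 i_1 ⋯ i_l} = ∂_{i_0} (∇^l f)_{i_1 ⋯ i_l}
  - ∑_s ∑_m Γ^m_{i_0 i_s} (∇^l f)_{i_1 ⋯ m ⋯ i_l}`, with `m` in the place of `i_s`. -/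
def covDeriv (f : EuclSp n → ℝ) : (l : ℕ) → (Fin l → Fin n) → EuclSp n → ℝ
  | 0, _, y => f y
  | l + 1, I, y =>
      pderiv (I 0) (covDeriv f l (Fin.tail I)) y
        - ∑ s : Fin l, ∑ m : Fin n, christoffel g φ m (I 0) (Fin.tail I s) y *
            covDeriv f l (Function.update (Fin.tail I) s m) y

/-- The scalar product `(∇^l f, ∇^l h)_g = g^{i_1 j_1} ⋯ g^{i_l j_l}
(∇^l f)_{i_1 ⋯ i_l} (∇^l h)_{j_1 ⋯ j_l}` in the chart `φ`. -/
def covInner (l : ℕ) (f h : EuclSp n → ℝ) (y : EuclSp n) : ℝ :=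
  ∑ I : Fin l → Fin n, ∑ J : Fin l → Fin n,
    (∏ s, gramInv g φ y (I s) (J s)) * covDeriv g φ f l I y * covDeriv g φ h l J y

/-- The divergence form `-(1/√det g) ∂_i (√det g · g^{ij} ∂_j f)` of `Δ_g f = -div_g (∇ f)` in the
chart `φ`. -/
def localLaplacian (f : EuclSp n → ℝ) (y : EuclSp n) : ℝ :=
  -((volDensity g φ y)⁻¹ * ∑ i, pderiv i
      (fun z => volDensity g φ z * ∑ j, gramInv g φ z i j * pderiv j f z) y)

end LocalExpressions

section LocalFacts

variable [IsManifold (𝓡 n) ∞ M] (g : RiemMetric n M) {φ : OpenPartialHomeomorph M (EuclSp n)}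

lemma contDiffOn_pderiv {s : Set (EuclSp n)} (hs : IsOpen s) {f : EuclSp n → ℝ}
    (hf : ContDiffOn ℝ ∞ f s) (i : Fin n) : ContDiffOn ℝ ∞ (pderiv i f) s := by
  have := (contDiffOn_infty_iff_fderiv_of_isOpen hs).1 hf
  exact this.2.clm_apply contDiffOn_const

lemma pderiv_add {s : Set (EuclSp n)} (hs : IsOpen s) {f h k : EuclSp n → ℝ}
    (hf : ContDiffOn ℝ ∞ f s) (hh : ContDiffOn ℝ ∞ h s) (hk : ∀ y ∈ s, k y = f y + h y)
    (i : Fin n) {y : EuclSp n} (hy : y ∈ s) : pderiv i k y = pderiv i f y + pderiv i h y := by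
  have hfy := (hf.contDiffAt (hs.mem_nhds hy)).differentiableAt (by simp)
  have hhy := (hh.contDiffAt (hs.mem_nhds hy)).differentiableAt (by simp)
  have : k =ᶠ[nhds y] f + h := Filter.eventuallyEq_of_mem (hs.mem_nhds hy) hk
  simp only [pderiv]
  rw [this.fderiv_eq, fderiv_add hfy hhy]; rfl

lemma pderiv_smul {s : Set (EuclSp n)} (hs : IsOpen s) {f k : EuclSp n → ℝ} (c : ℝ)
    (hf : ContDiffOn ℝ ∞ f s) (hk : ∀ y ∈ s, k y = c * f y)
    (i : Fin n) {y : EuclSp n} (hy : y ∈ s) : pderiv i k y = c * pderiv i f y := by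
  have hfy := (hf.contDiffAt (hs.mem_nhds hy)).differentiableAt (by simp)
  have : k =ᶠ[nhds y] c • f := Filter.eventuallyEq_of_mem (hs.mem_nhds hy) hk
  simp only [pderiv]
  rw [this.fderiv_eq, fderiv_const_smul hfy c]; rfl

lemma contDiffOn_gram (hφ : φ ∈ atlas (EuclSp n) M) (i j : Fin n) :
    ContDiffOn ℝ ∞ (fun y => gram g φ y i j) φ.target := by
  have key : ∀ i, ContMDiffOn (𝓡 n) ((𝓡 n).tangent) ∞
      (fun y => (⟨φ.symm y, coordVec φ i y⟩ : TangentBundle (𝓡 n) M)) φ.target := by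
    intro i
    have h1 := (contMDiffOn_symm_of_mem_maximalAtlas (n := ∞)
      (IsManifold.subset_maximalAtlas (I := 𝓡 n) hφ)).contMDiffOn_tangentMapWithin
        (m := ∞) (by simp) φ.open_target.uniqueMDiffOn
    have h2 : ContMDiff (𝓡 n) ((𝓡 n).tangent) ∞
        (fun y : EuclSp n => (⟨y, (EuclideanSpace.single i (1 : ℝ) : EuclSp n)⟩ :
          TangentBundle (𝓡 n) (EuclSp n))) := by
      exact contMDiff_vectorSpace_iff_contDiff.2 contDiff_const
    refine (h1.comp h2.contMDiffOn (fun y hy => hy)).congr ?_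
    intro y hy
    simp only [Function.comp, tangentMapWithin, coordVec]
    rw [mfderivWithin_of_isOpen φ.open_target hy]
  rw [← contMDiffOn_iff_contDiffOn]
  have hg : ContMDiffOn (𝓡 n) _ ∞ (fun y => Bundle.TotalSpace.mk' (EuclSp n →L[ℝ] EuclSp n →L[ℝ] ℝ)
      (E := fun (x : M) ↦ (TangentSpace (𝓡 n) x →L[ℝ] TangentSpace (𝓡 n) x →L[ℝ] ℝ))
      (φ.symm y) (g.inner (φ.symm y))) φ.target :=
    g.contMDiff.comp_contMDiffOn (contMDiffOn_symm_of_mem_maximalAtlas (n := ∞)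
      (IsManifold.subset_maximalAtlas (I := 𝓡 n) hφ))
  have := ContMDiffOn.clm_bundle_apply₂ (F₃ := ℝ) (E₃ := fun _ : M => ℝ) hg (key i) (key j)
  intro y hy
  have h3 := this y hy
  simp only [Bundle.contMDiffWithinAt_totalSpace] at h3
  exact h3.2

lemma posDef_gram (hφ : φ ∈ atlas (EuclSp n) M) {y : EuclSp n} (hy : y ∈ φ.target) :
    (gram g φ y).PosDef := by
  have hinj : Function.Injective (mfderiv (𝓡 n) (𝓡 n) φ.symm y) :=
    (mdifferentiable_of_mem_atlas (I := 𝓡 n) hφ).symm.mfderiv_injective hy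
  refine Matrix.PosDef.of_dotProduct_mulVec_pos ?_ ?_
  · ext i j
    simp [gram, g.symm (φ.symm y) (coordVec φ j y)]
  · intro x hx
    set v : EuclSp n := ∑ i, x i • (EuclideanSpace.single i (1 : ℝ) : EuclSp n) with hv
    have hvx : v ≠ 0 := by
      intro h0
      apply hx
      ext i
      have := congrArg (fun w : EuclSp n => w i) h0
      simpa [hv, Pi.single_apply] using this
    have hw : mfderiv (𝓡 n) (𝓡 n) φ.symm y v ≠ 0 := by
      intro h0
      exact hvx (hinj (h0.trans (map_zero _).symm))
    have hsum : mfderiv (𝓡 n) (𝓡 n) φ.symm y v = ∑ i, x i • coordVec φ i y := by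
      simp only [hv, coordVec]
      erw [map_sum]
      refine Finset.sum_congr rfl fun i _ => ?_
      erw [map_smul]
    have := g.pos _ _ hw
    rw [hsum] at this
    refine this.trans_eq ?_
    have e1 : ∀ w : TangentSpace (𝓡 n) (φ.symm y), g.inner (φ.symm y) w (∑ i, x i • coordVec φ i y)
        = ∑ j, g.inner (φ.symm y) w (coordVec φ j y) * x j := by
      intro w
      rw [map_sum]
      exact Finset.sum_congr rfl fun j _ => by rw [map_smul, smul_eq_mul, mul_comm]
    rw [g.symm, e1]
    simp only [dotProduct, Matrix.mulVec, gram, Matrix.of_apply, Pi.star_apply, star_trivial]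
    refine Finset.sum_congr rfl fun i _ => ?_
    rw [mul_comm, g.symm, e1]

lemma contDiffOn_det {s : Set (EuclSp n)} {A : EuclSp n → Matrix (Fin n) (Fin n) ℝ}
    (hA : ∀ i j, ContDiffOn ℝ ∞ (fun y => A y i j) s) :
    ContDiffOn ℝ ∞ (fun y => (A y).det) s := by
  simp only [Matrix.det_apply]
  refine ContDiffOn.sum fun σ _ => ?_
  exact (contDiffOn_prod fun i _ => hA _ _).const_smul _

lemma contDiffOn_gramInv (hφ : φ ∈ atlas (EuclSp n) M) (i j : Fin n) :
    ContDiffOn ℝ ∞ (fun y => gramInv g φ y i j) φ.target := by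
  have h1 : ContDiffOn ℝ ∞ (fun y => (gram g φ y).det) φ.target :=
    contDiffOn_det (contDiffOn_gram g hφ)
  have h2 : ContDiffOn ℝ ∞ (fun y => (gram g φ y).adjugate i j) φ.target := by
    simp only [Matrix.adjugate_apply]
    refine contDiffOn_det fun a b => ?_
    by_cases h : a = j
    · subst h
      simpa using contDiffOn_const
    · simpa [Matrix.updateRow_ne h] using contDiffOn_gram g hφ a b
  refine (h1.inv (fun y hy => (posDef_gram g hφ hy).det_pos.ne') |>.mul h2).congr ?_
  intro y hy
  simp [gramInv, Matrix.inv_def]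

lemma continuousOn_volDensity (hφ : φ ∈ atlas (EuclSp n) M) :
    ContinuousOn (volDensity g φ) φ.target :=
  (contDiffOn_det (contDiffOn_gram g hφ)).continuousOn.sqrt

lemma contDiffOn_christoffel (hφ : φ ∈ atlas (EuclSp n) M) (m i j : Fin n) :
    ContDiffOn ℝ ∞ (christoffel g φ m i j) φ.target := by
  refine contDiffOn_const.mul (ContDiffOn.sum fun l _ => (contDiffOn_gramInv g hφ m l).mul ?_)
  have h := fun a b c => contDiffOn_pderiv φ.open_target (contDiffOn_gram g hφ a b) c
  exact ((h _ _ _).add (h _ _ _)).sub (h _ _ _)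

lemma contDiffOn_covDeriv (hφ : φ ∈ atlas (EuclSp n) M) {f : EuclSp n → ℝ}
    (hf : ContDiffOn ℝ ∞ f φ.target) :
    ∀ (l : ℕ) (I : Fin l → Fin n), ContDiffOn ℝ ∞ (covDeriv g φ f l I) φ.target
  | 0, _ => hf
  | l + 1, _ => by
      have ih := contDiffOn_covDeriv hφ hf l
      exact (contDiffOn_pderiv φ.open_target (ih _) _).sub
        (ContDiffOn.sum fun s _ => ContDiffOn.sum fun m _ =>
          (contDiffOn_christoffel g hφ _ _ _).mul (ih _))

lemma covDeriv_add (hφ : φ ∈ atlas (EuclSp n) M) {f h : EuclSp n → ℝ}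
    (hf : ContDiffOn ℝ ∞ f φ.target) (hh : ContDiffOn ℝ ∞ h φ.target) :
    ∀ (l : ℕ) (I : Fin l → Fin n), ∀ y ∈ φ.target,
      covDeriv g φ (f + h) l I y = covDeriv g φ f l I y + covDeriv g φ h l I y
  | 0, _, _, _ => rfl
  | l + 1, I, y, hy => by
      have ih := covDeriv_add hφ hf hh l
      simp only [covDeriv]
      rw [pderiv_add φ.open_target (contDiffOn_covDeriv g hφ hf l _)
        (contDiffOn_covDeriv g hφ hh l _) (ih _) _ hy]
      simp only [fun J => ih J y hy, mul_add, Finset.sum_add_distrib]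
      ring

lemma covDeriv_smul (hφ : φ ∈ atlas (EuclSp n) M) {f : EuclSp n → ℝ} (c : ℝ)
    (hf : ContDiffOn ℝ ∞ f φ.target) :
    ∀ (l : ℕ) (I : Fin l → Fin n), ∀ y ∈ φ.target,
      covDeriv g φ (c • f) l I y = c * covDeriv g φ f l I y
  | 0, _, _, _ => rfl
  | l + 1, I, y, hy => by
      have ih := covDeriv_smul hφ c hf l
      simp only [covDeriv]
      rw [pderiv_smul φ.open_target c (contDiffOn_covDeriv g hφ hf l _) (ih _) _ hy]
      simp only [fun J => ih J y hy, mul_sub, Finset.mul_sum]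
      simp only [mul_left_comm]

lemma continuousOn_covInner (hφ : φ ∈ atlas (EuclSp n) M) {f h : EuclSp n → ℝ}
    (hf : ContDiffOn ℝ ∞ f φ.target) (hh : ContDiffOn ℝ ∞ h φ.target) (l : ℕ) :
    ContinuousOn (covInner g φ l f h) φ.target := by
  refine continuousOn_finsetSum _ fun I _ => continuousOn_finsetSum _ fun J _ => ?_
  exact ((continuousOn_finsetProd _ fun s _ => (contDiffOn_gramInv g hφ _ _).continuousOn).mul
    (contDiffOn_covDeriv g hφ hf l I).continuousOn).mul
    (contDiffOn_covDeriv g hφ hh l J).continuousOn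

lemma posDef_gramInv (hφ : φ ∈ atlas (EuclSp n) M) {y : EuclSp n} (hy : y ∈ φ.target) :
    (gramInv g φ y).PosDef := (posDef_gram g hφ hy).inv

lemma covInner_comm (hφ : φ ∈ atlas (EuclSp n) M) (l : ℕ) (f h : EuclSp n → ℝ)
    {y : EuclSp n} (hy : y ∈ φ.target) : covInner g φ l f h y = covInner g φ l h f y := by
  have hs : ∀ i j, gramInv g φ y i j = gramInv g φ y j i := fun i j => by
    simpa using (posDef_gramInv g hφ hy).1.apply j i
  unfold covInner
  rw [Finset.sum_comm]
  refine Finset.sum_congr rfl fun I _ => Finset.sum_congr rfl fun J _ => ?_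
  rw [Finset.prod_congr rfl fun s _ => hs (J s) (I s)]
  ring

open scoped MatrixOrder Matrix.Norms.L2Operator in
lemma covInner_self_nonneg (hφ : φ ∈ atlas (EuclSp n) M) (l : ℕ) (f : EuclSp n → ℝ)
    {y : EuclSp n} (hy : y ∈ φ.target) : 0 ≤ covInner g φ l f f y := by
  obtain ⟨B, hB⟩ := (CStarAlgebra.nonneg_iff_eq_star_mul_self (a := gramInv g φ y)).1
    (posDef_gramInv g hφ hy).posSemidef.nonneg
  have hB' : ∀ i j, gramInv g φ y i j = ∑ k, B k i * B k j := fun i j => by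
    rw [hB]; simp [Matrix.mul_apply, Matrix.star_eq_conjTranspose]
  have : covInner g φ l f f y
      = ∑ K : Fin l → Fin n, (∑ I, (∏ s, B (K s) (I s)) * covDeriv g φ f l I y) ^ 2 := by
    unfold covInner
    simp only [hB', Finset.prod_univ_sum, Fintype.piFinset_univ, Finset.prod_mul_distrib,
      Finset.sum_mul, sq, Finset.mul_sum]
    rw [Finset.sum_comm]
    conv_rhs => rw [Finset.sum_comm]
    refine Finset.sum_congr rfl fun I _ => ?_
    conv_rhs => rw [Finset.sum_comm]
    refine Finset.sum_congr rfl fun J _ => Finset.sum_congr rfl fun K _ => ?_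
    ring
  rw [this]
  exact Finset.sum_nonneg fun K _ => sq_nonneg _

lemma covInner_add_left (hφ : φ ∈ atlas (EuclSp n) M) (l : ℕ) {f₁ f₂ : EuclSp n → ℝ}
    (hf₁ : ContDiffOn ℝ ∞ f₁ φ.target) (hf₂ : ContDiffOn ℝ ∞ f₂ φ.target) (h : EuclSp n → ℝ)
    {y : EuclSp n} (hy : y ∈ φ.target) :
    covInner g φ l (f₁ + f₂) h y = covInner g φ l f₁ h y + covInner g φ l f₂ h y := by
  simp only [covInner, fun I => covDeriv_add g hφ hf₁ hf₂ l I y hy, mul_add, add_mul,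
    Finset.sum_add_distrib]

lemma covInner_smul_left (hφ : φ ∈ atlas (EuclSp n) M) (l : ℕ) (c : ℝ) {f : EuclSp n → ℝ}
    (hf : ContDiffOn ℝ ∞ f φ.target) (h : EuclSp n → ℝ) {y : EuclSp n} (hy : y ∈ φ.target) :
    covInner g φ l (c • f) h y = c * covInner g φ l f h y := by
  simp only [covInner, fun I => covDeriv_smul g hφ c hf l I y hy, Finset.mul_sum]
  refine Finset.sum_congr rfl fun I _ => Finset.sum_congr rfl fun J _ => ?_
  ring

lemma contDiffOn_comp_symm (hφ : φ ∈ atlas (EuclSp n) M) (u : SmoothFun n M) :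
    ContDiffOn ℝ ∞ (u ∘ φ.symm) φ.target := by
  rw [← contMDiffOn_iff_contDiffOn]
  exact u.contMDiff.comp_contMDiffOn (contMDiffOn_symm_of_mem_maximalAtlas (n := ∞)
      (IsManifold.subset_maximalAtlas (I := 𝓡 n) hφ))

end LocalFacts

section Integration

variable [IsManifold (𝓡 n) ∞ M] [T2Space M] [CompactSpace M]

variable (n M) in
/-- A smooth partition of unity `(ρ_p)` on `M`, with the support of `ρ_p` in the domain of the
preferred chart at `p`. -/
def chartPartition : SmoothPartitionOfUnity M (𝓡 n) M Set.univ :=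
  (SmoothPartitionOfUnity.exists_isSubordinate_chartAt_source (𝓡 n) M).choose

lemma tsupport_chartPartition (p : M) :
    tsupport (chartPartition n M p) ⊆ (chartAt (EuclSp n) p).source :=
  (SmoothPartitionOfUnity.exists_isSubordinate_chartAt_source (𝓡 n) M).choose_spec p

variable (n M) in
lemma finite_chartPartition :
    {p : M | (Function.support (chartPartition n M p)).Nonempty}.Finite :=
  (chartPartition n M).locallyFinite.finite_nonempty_of_compact

variable (n M) in
/-- The finitely many points `p` for which `ρ_p` is not identically zero. -/
def chartCenters : Finset M := (finite_chartPartition n M).toFinset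

/-- The integral `∫_M F dv_g` of a scalar field on `M` whose expression in the chart at `p` is
`F p`, by means of a partition of unity: `∑_p ∫ ρ_p F_p √(det g) dy`. (For local expressions of one
scalar field on `M`, the value does not depend on the partition of unity nor on the charts.) -/
def chartIntegral (g : RiemMetric n M) (F : M → EuclSp n → ℝ) : ℝ :=
  ∑ p ∈ chartCenters n M, ∫ y in (chartAt (EuclSp n) p).target,
    chartPartition n M p ((chartAt (EuclSp n) p).symm y) *
      volDensity g (chartAt (EuclSp n) p) y * F p y

lemma integrableOn_chart (g : RiemMetric n M) (p : M) {F : EuclSp n → ℝ}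
    (hF : ContinuousOn F (chartAt (EuclSp n) p).target) :
    MeasureTheory.IntegrableOn (fun y =>
      chartPartition n M p ((chartAt (EuclSp n) p).symm y) *
        volDensity g (chartAt (EuclSp n) p) y * F y) (chartAt (EuclSp n) p).target := by
  set φ := chartAt (EuclSp n) p with hφ
  set K : Set (EuclSp n) := φ '' tsupport (chartPartition n M p) with hK
  have hsub := tsupport_chartPartition (n := n) p
  have hKc : IsCompact K := ((isClosed_tsupport _).isCompact).image_of_continuousOn
    (φ.continuousOn.mono hsub)
  have hKt : K ⊆ φ.target := by
    rintro _ ⟨q, hq, rfl⟩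
    exact φ.map_source (hsub hq)
  have hcont : ContinuousOn (fun y => chartPartition n M p (φ.symm y) *
      volDensity g φ y * F y) φ.target :=
    (((chartPartition n M p).contMDiff.continuous.comp_continuousOn φ.continuousOn_symm).mul
      (continuousOn_volDensity g (chart_mem_atlas _ p))).mul hF
  have hint := (hcont.mono hKt).integrableOn_compact hKc (μ := MeasureTheory.volume)
  refine hint.of_forall_sdiff_eq_zero φ.open_target.measurableSet ?_
  rintro y ⟨hy, hyK⟩
  have : chartPartition n M p (φ.symm y) = 0 := by
    by_contra h
    exact hyK ⟨φ.symm y, subset_tsupport _ h, φ.right_inv hy⟩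
  simp [this]

/-- `∫_M f dv_g` for a function `f` on `M`. -/
def riemIntegral (g : RiemMetric n M) (f : M → ℝ) : ℝ :=
  chartIntegral g fun p y => f ((chartAt (EuclSp n) p).symm y)

/-- The Laplace-Beltrami operator `Δ_g = -div_g (∇ ·)`. -/
def laplaceBeltrami (g : RiemMetric n M) (f : M → ℝ) (p : M) : ℝ :=
  localLaplacian g (chartAt (EuclSp n) p) (f ∘ (chartAt (EuclSp n) p).symm)
    (chartAt (EuclSp n) p p)

/-- `∫_M (∇^l u, ∇^l v)_g dv_g`, where the scalar field `(∇^l u, ∇^l v)_g` is given by its expressions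
in the charts. -/
def covL2Inner (g : RiemMetric n M) (l : ℕ) (u v : SmoothFun n M) : ℝ :=
  chartIntegral g fun p =>
    covInner g (chartAt (EuclSp n) p) l (u ∘ (chartAt (EuclSp n) p).symm)
      (v ∘ (chartAt (EuclSp n) p).symm)

/-- The norm `‖∇^l u‖_2`. -/
def covL2Norm (g : RiemMetric n M) (l : ℕ) (u : SmoothFun n M) : ℝ := √(covL2Inner g l u u)

/-- The form `(u, v) ↦ ∫_M (∇^l u, ∇^l v)_g dv_g` is a positive semidefinite scalar product. -/
abbrev covL2Core (g : RiemMetric n M) (l : ℕ) : PreInnerProductSpace.Core ℝ (SmoothFun n M) where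
  inner u v := covL2Inner g l u v
  conj_inner_symm u v := by
    refine Finset.sum_congr rfl fun p _ => ?_
    refine MeasureTheory.setIntegral_congr_fun (chartAt (EuclSp n) p).open_target.measurableSet ?_
    intro y hy
    simp only
    rw [covInner_comm g (chart_mem_atlas _ p) l _ _ hy]
  re_inner_nonneg u := by
    refine Finset.sum_nonneg fun p _ => ?_
    refine MeasureTheory.setIntegral_nonneg (chartAt (EuclSp n) p).open_target.measurableSet ?_
    intro y hy
    exact mul_nonneg (mul_nonneg ((chartPartition n M).nonneg p _) (Real.sqrt_nonneg _))
      (covInner_self_nonneg g (chart_mem_atlas _ p) l _ hy)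
  add_left u v w := by
    have hc := fun (p : M) (u : SmoothFun n M) =>
      contDiffOn_comp_symm (chart_mem_atlas (EuclSp n) p) u
    simp only [covL2Inner, chartIntegral]
    rw [← Finset.sum_add_distrib]
    refine Finset.sum_congr rfl fun p _ => ?_
    rw [← MeasureTheory.integral_add
      (integrableOn_chart g p (continuousOn_covInner g (chart_mem_atlas _ p) (hc p u) (hc p w) l))
      (integrableOn_chart g p (continuousOn_covInner g (chart_mem_atlas _ p) (hc p v) (hc p w) l))]
    refine MeasureTheory.setIntegral_congr_fun (chartAt (EuclSp n) p).open_target.measurableSet ?_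
    intro y hy
    simp only [← mul_add]
    rw [← covInner_add_left g (chart_mem_atlas _ p) l (hc p u) (hc p v) _ hy]
    rfl
  smul_left u v c := by
    have hc := fun (p : M) (u : SmoothFun n M) =>
      contDiffOn_comp_symm (chart_mem_atlas (EuclSp n) p) u
    simp only [covL2Inner, chartIntegral]
    rw [Finset.mul_sum]
    refine Finset.sum_congr rfl fun p _ => ?_
    rw [← MeasureTheory.integral_const_mul]
    refine MeasureTheory.setIntegral_congr_fun (chartAt (EuclSp n) p).open_target.measurableSet ?_
    intro y hy
    simp only [conj_trivial]
    rw [mul_left_comm, ← covInner_smul_left g (chart_mem_atlas _ p) l c (hc p u) _ hy]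
    rfl

lemma covL2Norm_add_le (g : RiemMetric n M) (l : ℕ) (u v : SmoothFun n M) :
    covL2Norm g l (u + v) ≤ covL2Norm g l u + covL2Norm g l v :=
  letI := @InnerProductSpace.Core.toNorm ℝ _ _ _ _ (covL2Core g l)
  (InnerProductSpace.Core.toSeminormedSpaceCore (covL2Core g l)).norm_triangle u v

lemma covL2Norm_smul (g : RiemMetric n M) (l : ℕ) (c : ℝ) (u : SmoothFun n M) :
    covL2Norm g l (c • u) = |c| * covL2Norm g l u :=
  letI := @InnerProductSpace.Core.toNorm ℝ _ _ _ _ (covL2Core g l)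
  (InnerProductSpace.Core.toSeminormedSpaceCore (covL2Core g l)).norm_smul c u

end Integration

section SobolevSpace

variable [IsManifold (𝓡 n) ∞ M] [T2Space M] [CompactSpace M]

/-- The norm `‖u‖_{H_k^2} = ∑_{l=0}^k ‖∇^l u‖_2` of a smooth function. -/
def sobolevNorm (g : RiemMetric n M) (k : ℕ) (u : SmoothFun n M) : ℝ :=
  ∑ l ∈ Finset.range (k + 1), covL2Norm g l u

/-- The norm `‖u‖_2` of a smooth function. -/
def l2Norm (g : RiemMetric n M) (u : SmoothFun n M) : ℝ := √(riemIntegral g fun p => u p ^ 2)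

lemma l2Norm_eq (g : RiemMetric n M) (u : SmoothFun n M) : l2Norm g u = covL2Norm g 0 u := by
  have h : ∀ (φ : OpenPartialHomeomorph M (EuclSp n)) (f : EuclSp n → ℝ) (y : EuclSp n),
      covInner g φ 0 f f y = f y ^ 2 := fun φ f y => by simp [covInner, covDeriv, sq]
  simp only [l2Norm, covL2Norm, riemIntegral, covL2Inner, chartIntegral, h]
  rfl

lemma sobolevNorm_nonneg (g : RiemMetric n M) (k : ℕ) (u : SmoothFun n M) :
    0 ≤ sobolevNorm g k u :=
  Finset.sum_nonneg fun _ _ => Real.sqrt_nonneg _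

lemma sobolevNorm_smul (g : RiemMetric n M) (k : ℕ) (c : ℝ) (u : SmoothFun n M) :
    sobolevNorm g k (c • u) = |c| * sobolevNorm g k u := by
  simp only [sobolevNorm, covL2Norm_smul, Finset.mul_sum]

lemma sobolevNorm_add_le (g : RiemMetric n M) (k : ℕ) (u v : SmoothFun n M) :
    sobolevNorm g k (u + v) ≤ sobolevNorm g k u + sobolevNorm g k v := by
  simp only [sobolevNorm, ← Finset.sum_add_distrib]
  exact Finset.sum_le_sum fun l _ => covL2Norm_add_le g l u v

/-- The space `C^∞(M)`, to be endowed with the norm `‖·‖_{H_k^2}`. -/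
def PreSobolev (_g : RiemMetric n M) (_k : ℕ) : Type _ := SmoothFun n M

variable (g : RiemMetric n M) (k : ℕ)

instance : AddCommGroup (PreSobolev g k) := inferInstanceAs (AddCommGroup (SmoothFun n M))

instance : Module ℝ (PreSobolev g k) := inferInstanceAs (Module ℝ (SmoothFun n M))

instance : Norm (PreSobolev g k) := ⟨fun u => sobolevNorm g k u⟩

lemma preSobolev_core : SeminormedSpace.Core ℝ (PreSobolev g k) where
  norm_nonneg u := sobolevNorm_nonneg g k u
  norm_smul c u := sobolevNorm_smul g k c u
  norm_triangle u v := sobolevNorm_add_le g k u v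

instance : SeminormedAddCommGroup (PreSobolev g k) :=
  SeminormedAddCommGroup.ofCore (preSobolev_core g k)

instance : NormedSpace ℝ (PreSobolev g k) where
  norm_smul_le c u := (sobolevNorm_smul g k c u).le

/-- The space `H_k^2(M)`: the completion of `C^∞(M)` for the norm `‖·‖_{H_k^2}`. -/
abbrev Sobolev : Type _ := UniformSpace.Completion (PreSobolev g k)

variable {g k} in
/-- The canonical map `C^∞(M) → H_k^2(M)`. -/
def toSobolev (u : SmoothFun n M) : Sobolev g k :=
  UniformSpace.Completion.coe' (α := PreSobolev g k) u

lemma norm_toSobolev (u : SmoothFun n M) :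
    ‖(toSobolev u : Sobolev g k)‖ = sobolevNorm g k u :=
  UniformSpace.Completion.norm_coe (E := PreSobolev g k) u

variable {g k} in
/-- The extension to `H_k^2(M)` by continuity of the norm `‖·‖_2`. -/
def sobolevL2Norm : Sobolev g k → ℝ :=
  UniformSpace.Completion.extension (fun u : PreSobolev g k => l2Norm g u)

lemma l2Norm_sub_le (u v : SmoothFun n M) :
    l2Norm g u - l2Norm g v ≤ sobolevNorm g k (u - v) := by
  rw [l2Norm_eq, l2Norm_eq]
  have h1 := covL2Norm_add_le g 0 (u - v) v
  rw [sub_add_cancel] at h1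
  have h2 : covL2Norm g 0 (u - v) ≤ sobolevNorm g k (u - v) :=
    Finset.single_le_sum (f := fun l => covL2Norm g l (u - v)) (fun _ _ => Real.sqrt_nonneg _)
      (Finset.mem_range.2 k.succ_pos)
  linarith

lemma uniformContinuous_l2Norm :
    UniformContinuous (fun u : PreSobolev g k => l2Norm g u) := by
  refine (LipschitzWith.of_le_add fun u v => ?_).uniformContinuous
  have h : dist u v = sobolevNorm g k (u - v : SmoothFun n M) := dist_eq_norm u v
  have := l2Norm_sub_le g k u v
  rw [h]
  exact sub_le_iff_le_add'.1 this

lemma sobolevL2Norm_toSobolev (u : SmoothFun n M) :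
    sobolevL2Norm (toSobolev u : Sobolev g k) = l2Norm g u :=
  UniformSpace.Completion.extension_coe (uniformContinuous_l2Norm g k) _

end SobolevSpace

section Operators

variable [IsManifold (𝓡 n) ∞ M]

/-- `L` is a linear differential operator of order less than `m` with smooth coefficients: in every
chart, `L u` is a linear combination with smooth coefficients of the partial derivatives of `u` of
order less than `m`. -/
def IsDiffOpOfOrderLT (m : ℕ) (L : SmoothFun n M → M → ℝ) : Prop :=
  ∀ φ ∈ atlas (EuclSp n) M, ∃ a : (l : ℕ) → (Fin l → Fin n) → EuclSp n → ℝ,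
    (∀ l I, ContDiffOn ℝ ∞ (a l I) φ.target) ∧
    ∀ u : SmoothFun n M, ∀ y ∈ φ.target,
      L u (φ.symm y) = ∑ l ∈ Finset.range m, ∑ I : Fin l → Fin n,
        a l I y * iteratedFDeriv ℝ l (u ∘ φ.symm) y fun s => EuclideanSpace.single (I s) 1

/-- `P = Δ_g^k + lower order terms`: the difference `P - Δ_g^k` is a differential operator of order
less than `2k`. -/
def HasLeadingPart (g : RiemMetric n M) (k : ℕ) (P : SmoothFun n M →ₗ[ℝ] SmoothFun n M) : Prop :=
  IsDiffOpOfOrderLT (2 * k) fun u p => P u p - (laplaceBeltrami g)^[k] u p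

variable [T2Space M] [CompactSpace M]

/-- `P` is self-adjoint with respect to the `L²` scalar product:
`∫_M u P v dv_g = ∫_M (P u) v dv_g` for all smooth `u`, `v`. -/
def IsL2SelfAdjoint (g : RiemMetric n M) (P : SmoothFun n M →ₗ[ℝ] SmoothFun n M) : Prop :=
  ∀ u v : SmoothFun n M,
    riemIntegral g (fun p => u p * P v p) = riemIntegral g (fun p => P u p * v p)

variable {g : RiemMetric n M} {k : ℕ}

/-- The continuous bilinear form `B` on `H_k^2(M)` extends `(u, v) ↦ ∫_M u P v dv_g`. (There is at
most one such `B`, since `C^∞(M)` is dense.) -/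
def ExtendsEnergy (P : SmoothFun n M →ₗ[ℝ] SmoothFun n M)
    (B : Sobolev g k →L[ℝ] Sobolev g k →L[ℝ] ℝ) : Prop :=
  ∀ u v : SmoothFun n M,
    B (toSobolev u) (toSobolev v) = riemIntegral g fun p => u p * P v p

/-- Coercivity: there is `c > 0` with `B(u, u) ≥ c ‖u‖_2^2` for all `u ∈ H_k^2(M)`. -/
def IsCoerciveL2 (B : Sobolev g k →L[ℝ] Sobolev g k →L[ℝ] ℝ) : Prop :=
  ∃ c : ℝ, 0 < c ∧ ∀ u : Sobolev g k, c * sobolevL2Norm u ^ 2 ≤ B u u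

end Operators

section Norms

variable {V : Type*} [AddCommGroup V] [Module ℝ V]

/-- `N` is a norm on the real vector space `V`. -/
structure IsNorm (N : V → ℝ) : Prop where
  nonneg : ∀ u, 0 ≤ N u
  eq_zero_iff : ∀ u, N u = 0 ↔ u = 0
  smul : ∀ (c : ℝ) u, N (c • u) = |c| * N u
  add_le : ∀ u v, N (u + v) ≤ N u + N v

/-- The functions `N₁` and `N₂` (two norms) are equivalent. -/
def AreEquivalent (N₁ N₂ : V → ℝ) : Prop :=
  ∃ C₁ > 0, ∃ C₂ > 0, ∀ u, C₁ * N₂ u ≤ N₁ u ∧ N₁ u ≤ C₂ * N₂ u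

end Norms

end

end RiemSobolev

/-!
The energy is, up to lower order terms, the squared norm of the top covariant derivative:
`∫ u P v = ∫ (∇^k u, ∇^k v)_g + O(‖u‖_{H_k^2} ‖v‖_{H_{k-1}^2})` (`energy_sub_covL2Inner_isBigO`).
In a chart the leading part of `P` is `(-1)^k g^{i_1 j_1} ⋯ g^{i_k j_k} ∂_I ∂_J`, and moving the `k`
derivatives `∂_I` to the other factor by integration by parts gives `∏ g^{i_s j_s} ∂_I u ∂_J v`,
which is the leading part of `(∇^k u, ∇^k v)_g`. Since the norm of `H_k^2` contains all covariant
derivatives, no elliptic regularity is needed: continuity of the energy (`energy_isBigO`) and the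
Gårding inequality `∫ u P u ≥ c ‖u‖²_{H_k^2} - C ‖u‖_2²` (`exists_garding`) follow, the latter with
the help of Ehrling's inequality `‖u‖_{H_{k-1}^2} ≤ ε ‖u‖_{H_k^2} + C ‖u‖_2`, which is itself proved
by integration by parts. Coercivity absorbs the term `C ‖u‖_2²`.

Two points make the local computations legitimate. The Laplacian at a point is defined by means of
the preferred chart at that point, so that its invariance under changes of charts is needed; it is
obtained from the weak form (`localLaplacian_transition`). And the error terms of the integrations
by parts involve derivatives of the partition of unity, so that they have to be estimated by
integrals over whole compact subsets of charts; these are controlled by the Sobolev norms, which are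
defined with the partition of unity, by a change of variables
(`exists_setIntegral_sq_multiDeriv_le`).

Estimates uniform in `(u, v)` are written as `=O[⊤]` on `C^∞(M) × C^∞(M)`.
-/

namespace RiemSobolev

noncomputable section

attribute [local instance 2000] chartedSpaceSelf

/-! ### Iterated partial derivatives -/

section Calculus

variable {n : ℕ} {U : Set (EuclSp n)}

lemma pderiv_congr (hU : IsOpen U) {f h : EuclSp n → ℝ} (hfh : ∀ y ∈ U, f y = h y) (i : Fin n)
    {y : EuclSp n} (hy : y ∈ U) : pderiv i f y = pderiv i h y := by
  simp only [pderiv, (Filter.eventuallyEq_of_mem (hU.mem_nhds hy) hfh).fderiv_eq]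

lemma pderiv_mul (hU : IsOpen U) {f h : EuclSp n → ℝ} (hf : ContDiffOn ℝ ∞ f U)
    (hh : ContDiffOn ℝ ∞ h U) (i : Fin n) {y : EuclSp n} (hy : y ∈ U) :
    pderiv i (fun z => f z * h z) y = pderiv i f y * h y + f y * pderiv i h y := by
  have hfy := (hf.contDiffAt (hU.mem_nhds hy)).differentiableAt (by simp)
  have hhy := (hh.contDiffAt (hU.mem_nhds hy)).differentiableAt (by simp)
  simp only [pderiv]
  rw [fderiv_fun_mul hfy hhy]
  simp
  ring

lemma pderiv_sum (hU : IsOpen U) {ι : Type*} (s : Finset ι) {f : ι → EuclSp n → ℝ}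
    (hf : ∀ a ∈ s, ContDiffOn ℝ ∞ (f a) U) (i : Fin n) {y : EuclSp n} (hy : y ∈ U) :
    pderiv i (fun z => ∑ a ∈ s, f a z) y = ∑ a ∈ s, pderiv i (f a) y := by
  simp only [pderiv]
  rw [fderiv_fun_sum fun a ha =>
    ((hf a ha).contDiffAt (hU.mem_nhds hy)).differentiableAt (by simp)]
  simp

lemma pderiv_comm (hU : IsOpen U) {f : EuclSp n → ℝ} (hf : ContDiffOn ℝ ∞ f U) (i j : Fin n)
    {y : EuclSp n} (hy : y ∈ U) : pderiv i (pderiv j f) y = pderiv j (pderiv i f) y := by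
  have hfy := hf.contDiffAt (hU.mem_nhds hy)
  have hd : DifferentiableAt ℝ (fderiv ℝ f) y :=
    (hfy.fderiv_right (m := ∞) (by simp)).differentiableAt (by simp)
  have key : ∀ v w : EuclSp n,
      fderiv ℝ (fun z => fderiv ℝ f z v) y w = fderiv ℝ (fderiv ℝ f) y w v := by
    intro v w
    rw [fderiv_clm_apply hd (differentiableAt_const v)]
    simp
  unfold pderiv
  rw [key, key]
  exact hfy.isSymmSndFDerivAt (by simpa using WithTop.coe_le_coe.2 (le_top : (2 : ℕ∞) ≤ ⊤)) _ _

/-- The iterated partial derivative `∂_{i_1} ⋯ ∂_{i_m} f` along the list `[i_1, …, i_m]`. -/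
def multiDeriv : List (Fin n) → (EuclSp n → ℝ) → EuclSp n → ℝ
  | [], f => f
  | i :: α, f => pderiv i (multiDeriv α f)

lemma contDiffOn_multiDeriv (hU : IsOpen U) {f : EuclSp n → ℝ} (hf : ContDiffOn ℝ ∞ f U) :
    ∀ α : List (Fin n), ContDiffOn ℝ ∞ (multiDeriv α f) U
  | [] => hf
  | i :: α => contDiffOn_pderiv hU (contDiffOn_multiDeriv hU hf α) i

lemma multiDeriv_congr (hU : IsOpen U) {f h : EuclSp n → ℝ} (hfh : ∀ y ∈ U, f y = h y) :
    ∀ (α : List (Fin n)), ∀ y ∈ U, multiDeriv α f y = multiDeriv α h y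
  | [], y, hy => hfh y hy
  | i :: α, _, hy => pderiv_congr hU (multiDeriv_congr hU hfh α) i hy

/-- Partial derivatives of a smooth function commute, hence only the multiset of indices matters. -/
lemma multiDeriv_perm (hU : IsOpen U) {f : EuclSp n → ℝ} (hf : ContDiffOn ℝ ∞ f U)
    {α β : List (Fin n)} (h : α.Perm β) : ∀ y ∈ U, multiDeriv α f y = multiDeriv β f y := by
  induction h with
  | nil => exact fun _ _ => rfl
  | cons i _ ih => exact fun y hy => pderiv_congr hU ih i hy
  | swap i j α => exact fun y hy => pderiv_comm hU (contDiffOn_multiDeriv hU hf α) _ _ hy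
  | trans _ _ ih₁ ih₂ => exact fun y hy => (ih₁ y hy).trans (ih₂ y hy)

lemma multiDeriv_ofFn (hU : IsOpen U) {f : EuclSp n → ℝ} (hf : ContDiffOn ℝ ∞ f U) :
    ∀ (l : ℕ) (I : Fin l → Fin n), ∀ y ∈ U, multiDeriv (List.ofFn I) f y =
      iteratedFDeriv ℝ l f y fun s => EuclideanSpace.single (I s) 1
  | 0, _, _, _ => by simp [multiDeriv]
  | l + 1, I, y, hy => by
      have ih := multiDeriv_ofFn hU hf l (Fin.tail I)
      rw [List.ofFn_succ, multiDeriv]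
      refine (pderiv_congr hU ih _ hy).trans ?_
      rw [iteratedFDeriv_succ_apply_left]
      have hd : DifferentiableAt ℝ (iteratedFDeriv ℝ l f) y :=
        (hf.contDiffAt (hU.mem_nhds hy)).differentiableAt_iteratedFDeriv
          (by exact_mod_cast ENat.natCast_lt_top l)
      unfold pderiv
      have := (hd.hasFDerivAt.continuousMultilinear_apply_const
        (fun s => (EuclideanSpace.single (Fin.tail I s) (1 : ℝ) : EuclSp n))).fderiv
      rw [this]
      rfl

lemma abs_multiDeriv_le (hU : IsOpen U) {f : EuclSp n → ℝ} (hf : ContDiffOn ℝ ∞ f U)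
    (α : List (Fin n)) {y : EuclSp n} (hy : y ∈ U) :
    |multiDeriv α f y| ≤ ‖iteratedFDeriv ℝ α.length f y‖ := by
  have := multiDeriv_ofFn hU hf _ α.get y hy
  rw [List.ofFn_get] at this
  rw [this, ← Real.norm_eq_abs]
  refine ((iteratedFDeriv ℝ α.length f y).le_opNorm _).trans_eq ?_
  simp

lemma norm_iteratedFDeriv_le (hU : IsOpen U) {f : EuclSp n → ℝ} (hf : ContDiffOn ℝ ∞ f U)
    (l : ℕ) {y : EuclSp n} (hy : y ∈ U) :
    ‖iteratedFDeriv ℝ l f y‖ ≤ ∑ I : Fin l → Fin n, |multiDeriv (List.ofFn I) f y| := by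
  refine ContinuousMultilinearMap.opNorm_le_bound (Finset.sum_nonneg fun _ _ => abs_nonneg _) ?_
  intro m
  have hm : ∀ s, m s = ∑ i, m s i • (EuclideanSpace.single i (1 : ℝ) : EuclSp n) := by
    intro s
    have := (EuclideanSpace.basisFun (Fin n) ℝ).sum_repr (m s)
    simpa using this.symm
  have h1 : iteratedFDeriv ℝ l f y m = ∑ I : Fin l → Fin n,
      (∏ s, m s (I s)) * multiDeriv (List.ofFn I) f y := by
    conv_lhs => rw [show m = fun s => ∑ i, m s i • (EuclideanSpace.single i (1 : ℝ) : EuclSp n)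
      from funext hm]
    rw [ContinuousMultilinearMap.map_sum]
    refine Finset.sum_congr rfl fun I _ => ?_
    rw [ContinuousMultilinearMap.map_smul_univ, multiDeriv_ofFn hU hf l I y hy, smul_eq_mul]
  rw [h1, Finset.sum_mul]
  refine (norm_sum_le _ _).trans (Finset.sum_le_sum fun I _ => ?_)
  rw [norm_mul, mul_comm, Real.norm_eq_abs]
  refine mul_le_mul_of_nonneg_left ?_ (abs_nonneg _)
  rw [norm_prod]
  exact Finset.prod_le_prod (fun _ _ => norm_nonneg _) fun s _ => PiLp.norm_apply_le (m s) (I s)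

end Calculus

/-! ### Linear differential operators on an open set -/

section Operators

variable {n : ℕ} {U : Set (EuclSp n)}

/-- `A` is, on smooth functions on `U`, a linear differential operator of order less than `m` with
coefficients smooth on `U`. Values outside `U` and on non-smooth functions are unconstrained. -/
inductive LowerOrder (U : Set (EuclSp n)) (m : ℕ) : ((EuclSp n → ℝ) → EuclSp n → ℝ) → Prop
  | zero : LowerOrder U m fun _ _ => 0
  | monomial (a : EuclSp n → ℝ) (α : List (Fin n)) : ContDiffOn ℝ ∞ a U → α.length < m →
      LowerOrder U m fun f y => a y * multiDeriv α f y
  | add {A B : (EuclSp n → ℝ) → EuclSp n → ℝ} : LowerOrder U m A → LowerOrder U m B →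
      LowerOrder U m fun f y => A f y + B f y
  | congr {A B : (EuclSp n → ℝ) → EuclSp n → ℝ} : LowerOrder U m A →
      (∀ f, ContDiffOn ℝ ∞ f U → ∀ y ∈ U, B f y = A f y) → LowerOrder U m B

namespace LowerOrder

variable {m : ℕ} {A B : (EuclSp n → ℝ) → EuclSp n → ℝ}

lemma contDiffOn (hU : IsOpen U) (hA : LowerOrder U m A) {f : EuclSp n → ℝ}
    (hf : ContDiffOn ℝ ∞ f U) : ContDiffOn ℝ ∞ (A f) U := by
  induction hA with
  | zero => exact contDiffOn_const
  | monomial a α ha _ => exact ha.mul (contDiffOn_multiDeriv hU hf α)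
  | add _ _ ih₁ ih₂ => exact ih₁.add ih₂
  | congr _ h ih => exact ih.congr (h f hf)

lemma mono (hA : LowerOrder U m A) {m' : ℕ} (h : m ≤ m') : LowerOrder U m' A := by
  induction hA with
  | zero => exact zero
  | monomial a α ha hα => exact monomial a α ha (hα.trans_le h)
  | add _ _ ih₁ ih₂ => exact ih₁.add ih₂
  | congr _ h ih => exact ih.congr h

lemma smul (hA : LowerOrder U m A) {b : EuclSp n → ℝ} (hb : ContDiffOn ℝ ∞ b U) :
    LowerOrder U m fun f y => b y * A f y := by
  induction hA with
  | zero => exact zero.congr fun f _ y _ => by simp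
  | monomial a α ha hα =>
      exact (monomial (fun y => b y * a y) α (hb.mul ha) hα).congr fun f _ y _ => by ring
  | add _ _ ih₁ ih₂ => exact (ih₁.add ih₂).congr fun f _ y _ => by ring
  | congr _ h ih => exact ih.congr fun f hf y hy => by rw [h f hf y hy]

lemma neg (hA : LowerOrder U m A) : LowerOrder U m fun f y => -A f y :=
  (hA.smul (b := fun _ => -1) contDiffOn_const).congr fun f _ y _ => by ring

lemma sub (hA : LowerOrder U m A) (hB : LowerOrder U m B) :
    LowerOrder U m fun f y => A f y - B f y :=
  (hA.add hB.neg).congr fun f _ y _ => by ring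

lemma sum {ι : Type*} (s : Finset ι) {A : ι → (EuclSp n → ℝ) → EuclSp n → ℝ}
    (hA : ∀ i ∈ s, LowerOrder U m (A i)) : LowerOrder U m fun f y => ∑ i ∈ s, A i f y := by
  classical
  induction s using Finset.induction_on with
  | empty => exact zero.congr fun f _ y _ => by simp
  | insert i s hi ih =>
      refine ((hA i (by simp)).add (ih fun j hj => hA j (by simp [hj]))).congr fun f _ y _ => ?_
      rw [Finset.sum_insert hi]

lemma multiDeriv {α : List (Fin n)} (hα : α.length < m) : LowerOrder U m (multiDeriv α) :=
  (monomial (fun _ => 1) α contDiffOn_const hα).congr fun f _ y _ => by ring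

lemma pderiv (hU : IsOpen U) (hA : LowerOrder U m A) (i : Fin n) :
    LowerOrder U (m + 1) fun f => pderiv i (A f) := by
  induction hA with
  | zero => exact zero.congr fun f _ y _ => by simp [RiemSobolev.pderiv]
  | monomial a α ha hα =>
      refine ((monomial (RiemSobolev.pderiv i a) α (contDiffOn_pderiv hU ha i)
        (hα.trans (Nat.lt_succ_self _))).add (monomial a (i :: α) ha (by simpa using hα))).congr ?_
      intro f hf y hy
      rw [pderiv_mul hU ha (contDiffOn_multiDeriv hU hf α) i hy]
      rfl
  | add h₁ h₂ ih₁ ih₂ =>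
      exact (ih₁.add ih₂).congr fun f hf y hy => pderiv_add hU (h₁.contDiffOn hU hf)
        (h₂.contDiffOn hU hf) (fun _ _ => rfl) i hy
  | congr _ h ih => exact ih.congr fun f hf y hy => pderiv_congr hU (h f hf) i hy

/-- Leibniz rule: when a monomial `a ∂^α` is differentiated, only the term in which the derivative
falls on `∂^α f` is of top order. -/
lemma pderiv_monomial_sub (hU : IsOpen U) {a : EuclSp n → ℝ} (ha : ContDiffOn ℝ ∞ a U)
    {α : List (Fin n)} (hα : α.length < m) (i : Fin n) : LowerOrder U m fun f y =>
      RiemSobolev.pderiv i (fun z => a z * RiemSobolev.multiDeriv α f z) y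
        - a y * RiemSobolev.multiDeriv (i :: α) f y := by
  refine (monomial (RiemSobolev.pderiv i a) α (contDiffOn_pderiv hU ha i) hα).congr ?_
  intro f hf y hy
  rw [pderiv_mul hU ha (contDiffOn_multiDeriv hU hf α) i hy]
  simp [RiemSobolev.multiDeriv]

/-- Pointwise bound on a compact set for an operator of order less than `m`. -/
lemma exists_bound (hA : LowerOrder U m A) {K : Set (EuclSp n)} (hK : IsCompact K) (hKU : K ⊆ U) :
    ∃ C, 0 ≤ C ∧ ∀ f, ContDiffOn ℝ ∞ f U → ∀ y ∈ K, |A f y| ≤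
      C * ∑ l ∈ Finset.range m, ∑ I : Fin l → Fin n, |RiemSobolev.multiDeriv (List.ofFn I) f y| := by
  induction hA with
  | zero => exact ⟨0, le_rfl, by simp⟩
  | monomial a α ha hα =>
      obtain ⟨C, hC⟩ := hK.exists_bound_of_continuousOn (ha.continuousOn.mono hKU)
      refine ⟨max C 0, le_max_right _ _, fun f _ y hy => ?_⟩
      rw [abs_mul]
      refine mul_le_mul ((hC y hy).trans (le_max_left _ _)) ?_ (abs_nonneg _) (le_max_right _ _)
      have h1 : |RiemSobolev.multiDeriv α f y| ≤ ∑ I : Fin α.length → Fin n,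
          |RiemSobolev.multiDeriv (List.ofFn I) f y| := by
        have := Finset.single_le_sum (f := fun I : Fin α.length → Fin n =>
          |RiemSobolev.multiDeriv (List.ofFn I) f y|) (fun _ _ => abs_nonneg _)
          (Finset.mem_univ α.get)
        simpa only [List.ofFn_get] using this
      exact h1.trans (Finset.single_le_sum (f := fun l => ∑ I : Fin l → Fin n,
        |RiemSobolev.multiDeriv (List.ofFn I) f y|)
        (fun _ _ => Finset.sum_nonneg fun _ _ => abs_nonneg _) (Finset.mem_range.2 hα))
  | add _ _ ih₁ ih₂ =>
      obtain ⟨C₁, h₁, h₁'⟩ := ih₁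
      obtain ⟨C₂, h₂, h₂'⟩ := ih₂
      refine ⟨C₁ + C₂, add_nonneg h₁ h₂, fun f hf y hy => (abs_add_le _ _).trans ?_⟩
      rw [add_mul]
      exact add_le_add (h₁' f hf y hy) (h₂' f hf y hy)
  | congr _ h ih =>
      obtain ⟨C, h₁, h₁'⟩ := ih
      exact ⟨C, h₁, fun f hf y hy => by rw [h f hf y (hKU hy)]; exact h₁' f hf y hy⟩

end LowerOrder

end Operators

/-! ### Compactly supported weights and integration by parts -/

section Weights

variable {n : ℕ} {U : Set (EuclSp n)}

/-- `w` is a test function on `U`. -/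
structure IsWeight (U : Set (EuclSp n)) (w : EuclSp n → ℝ) : Prop where
  contDiff : ContDiff ℝ ∞ w
  compact : HasCompactSupport w
  subset : tsupport w ⊆ U

lemma contDiff_of_contDiffOn_of_tsupport_subset (hU : IsOpen U) {f : EuclSp n → ℝ}
    (hf : ContDiffOn ℝ ∞ f U) (h : tsupport f ⊆ U) : ContDiff ℝ ∞ f := by
  rw [contDiff_iff_contDiffAt]
  intro x
  by_cases hx : x ∈ tsupport f
  · exact hf.contDiffAt (hU.mem_nhds (h hx))
  · exact contDiffAt_const.congr_of_eventuallyEq (notMem_tsupport_iff_eventuallyEq.1 hx)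

namespace IsWeight

variable {w : EuclSp n → ℝ}

lemma mul (hU : IsOpen U) (hw : IsWeight U w) {a : EuclSp n → ℝ} (ha : ContDiffOn ℝ ∞ a U) :
    IsWeight U fun y => w y * a y := by
  have hs : tsupport (fun y => w y * a y) ⊆ U := (tsupport_mul_subset_left).trans hw.subset
  exact ⟨contDiff_of_contDiffOn_of_tsupport_subset hU (hw.contDiff.contDiffOn.mul ha) hs,
    hw.compact.mul_right, hs⟩

lemma pderiv (hw : IsWeight U w) (i : Fin n) : IsWeight U (pderiv i w) where
  contDiff := contDiffOn_univ.1 (contDiffOn_pderiv isOpen_univ hw.contDiff.contDiffOn i)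
  compact := hw.compact.fderiv_apply (𝕜 := ℝ) _
  subset := (tsupport_fderiv_apply_subset ℝ _).trans hw.subset

lemma integrable (hw : IsWeight U w) : MeasureTheory.Integrable w :=
  hw.contDiff.continuous.integrable_of_hasCompactSupport hw.compact

lemma integral_pderiv_mul (hU : IsOpen U) (hw : IsWeight U w) {f : EuclSp n → ℝ}
    (hf : ContDiffOn ℝ ∞ f U) (i : Fin n) :
    ∫ y, RiemSobolev.pderiv i w y * f y = -∫ y, w y * RiemSobolev.pderiv i f y := by
  have h := integral_mul_fderiv_eq_neg_fderiv_mul_of_integrable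
    (f := w) (g := f) (v := EuclideanSpace.single i (1 : ℝ)) (μ := MeasureTheory.volume)
    ((hw.pderiv i).mul hU hf).integrable (hw.mul hU (contDiffOn_pderiv hU hf i)).integrable
    (hw.mul hU hf).integrable
    (fun x _ => hw.contDiff.differentiable (by simp) x)
    (fun x hx => (hf.contDiffAt (hU.mem_nhds (hw.subset hx))).differentiableAt (by simp))
  simp only [RiemSobolev.pderiv] at h ⊢
  rw [h, neg_neg]

/-- Integration by parts of one derivative in a bilinear expression with a weight. -/
lemma integral_mul_pderiv_mul (hU : IsOpen U) (hw : IsWeight U w) {f h : EuclSp n → ℝ}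
    (hf : ContDiffOn ℝ ∞ f U) (hh : ContDiffOn ℝ ∞ h U) (i : Fin n) :
    ∫ y, w y * RiemSobolev.pderiv i f y * h y =
      -(∫ y, w y * f y * RiemSobolev.pderiv i h y) - ∫ y, RiemSobolev.pderiv i w y * f y * h y := by
  have h1 := (hw.mul hU hh).integral_pderiv_mul hU hf i
  have h2 : ∀ y, RiemSobolev.pderiv i (fun y => w y * h y) y * f y =
      RiemSobolev.pderiv i w y * f y * h y + w y * f y * RiemSobolev.pderiv i h y := by
    intro y
    by_cases hy : y ∈ U
    · rw [pderiv_mul hU hw.contDiff.contDiffOn hh i hy]; ring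
    · have e1 : w y = 0 := image_eq_zero_of_notMem_tsupport fun h => hy (hw.subset h)
      have e2 : RiemSobolev.pderiv i w y = 0 :=
        image_eq_zero_of_notMem_tsupport fun h => hy ((hw.pderiv i).subset h)
      have e3 : RiemSobolev.pderiv i (fun y => w y * h y) y = 0 :=
        image_eq_zero_of_notMem_tsupport fun h' => hy (((hw.mul hU hh).pderiv i).subset h')
      simp [e1, e2, e3]
  simp only [h2] at h1
  rw [MeasureTheory.integral_add] at h1
  · have h3 : ∀ y, w y * RiemSobolev.pderiv i f y * h y = w y * h y * RiemSobolev.pderiv i f y :=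
      fun y => by ring
    simp only [h3]
    linarith
  · exact (((hw.pderiv i).mul hU hf).mul hU hh).integrable
  · exact ((hw.mul hU hf).mul hU (contDiffOn_pderiv hU hh i)).integrable

end IsWeight

end Weights

/-! ### Leading parts of the Laplacian and of the covariant derivatives in a chart -/

section LeadingParts

variable {n : ℕ} {M : Type*} [TopologicalSpace M] [ChartedSpace (EuclSp n) M]
  [IsManifold (𝓡 n) ∞ M] (g : RiemMetric n M) {φ : OpenPartialHomeomorph M (EuclSp n)}

lemma contDiffOn_volDensity (hφ : φ ∈ atlas (EuclSp n) M) :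
    ContDiffOn ℝ ∞ (volDensity g φ) φ.target :=
  (contDiffOn_det (contDiffOn_gram g hφ)).sqrt fun _ hy => (posDef_gram g hφ hy).det_pos.ne'

lemma volDensity_pos (hφ : φ ∈ atlas (EuclSp n) M) {y : EuclSp n} (hy : y ∈ φ.target) :
    0 < volDensity g φ y :=
  Real.sqrt_pos.2 (posDef_gram g hφ hy).det_pos

lemma localLaplacian_congr {f h : EuclSp n → ℝ} (hfh : ∀ y ∈ φ.target, f y = h y) :
    ∀ y ∈ φ.target, localLaplacian g φ f y = localLaplacian g φ h y := by
  intro y hy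
  unfold localLaplacian
  congr 2
  refine Finset.sum_congr rfl fun i _ => pderiv_congr φ.open_target (fun z hz => ?_) i hy
  congr 1
  exact Finset.sum_congr rfl fun j _ => by rw [pderiv_congr φ.open_target hfh j hz]

/-- The coefficient of `∂_j` when the divergence form of the Laplacian is expanded. -/
def laplacianDrift (φ : OpenPartialHomeomorph M (EuclSp n)) (j : Fin n) (y : EuclSp n) : ℝ :=
  -((volDensity g φ y)⁻¹ * ∑ i, pderiv i (fun z => volDensity g φ z * gramInv g φ z i j) y)

lemma contDiffOn_laplacianDrift (hφ : φ ∈ atlas (EuclSp n) M) (j : Fin n) :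
    ContDiffOn ℝ ∞ (laplacianDrift g φ j) φ.target :=
  (((contDiffOn_volDensity g hφ).inv fun _ hy => (volDensity_pos g hφ hy).ne').mul
    (ContDiffOn.sum fun i _ => contDiffOn_pderiv φ.open_target
      ((contDiffOn_volDensity g hφ).mul (contDiffOn_gramInv g hφ i j)) i)).neg

lemma localLaplacian_eq (hφ : φ ∈ atlas (EuclSp n) M) {f : EuclSp n → ℝ}
    (hf : ContDiffOn ℝ ∞ f φ.target) {y : EuclSp n} (hy : y ∈ φ.target) :
    localLaplacian g φ f y = ∑ i, ∑ j, -gramInv g φ y i j * pderiv i (pderiv j f) y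
      + ∑ j, laplacianDrift g φ j y * pderiv j f y := by
  have hU := φ.open_target
  have h1 : ∀ i, pderiv i (fun z => volDensity g φ z * ∑ j, gramInv g φ z i j * pderiv j f z) y =
      ∑ j, (pderiv i (fun z => volDensity g φ z * gramInv g φ z i j) y * pderiv j f y
        + volDensity g φ y * gramInv g φ y i j * pderiv i (pderiv j f) y) := by
    intro i
    have e : ∀ z, volDensity g φ z * ∑ j, gramInv g φ z i j * pderiv j f z =
        ∑ j, (volDensity g φ z * gramInv g φ z i j) * pderiv j f z := fun z => by
      rw [Finset.mul_sum]; exact Finset.sum_congr rfl fun j _ => by ring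
    simp only [e]
    have hs := fun j => (contDiffOn_volDensity g hφ).mul (contDiffOn_gramInv g hφ i j)
    rw [pderiv_sum hU Finset.univ (fun j _ => (hs j).mul (contDiffOn_pderiv hU hf j)) i hy]
    exact Finset.sum_congr rfl fun j _ => pderiv_mul hU (hs j) (contDiffOn_pderiv hU hf j) i hy
  have hv := (volDensity_pos g hφ hy).ne'
  unfold localLaplacian laplacianDrift
  rw [Finset.sum_congr rfl fun i _ => h1 i]
  simp only [Finset.sum_add_distrib, Finset.mul_sum, mul_add, neg_add, Finset.sum_mul,
    ← Finset.sum_neg_distrib]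
  rw [add_comm]
  congr 1
  · refine Finset.sum_congr rfl fun i _ => Finset.sum_congr rfl fun j _ => ?_
    field_simp
  · rw [Finset.sum_comm]
    refine Finset.sum_congr rfl fun i _ => Finset.sum_congr rfl fun j _ => ?_
    ring

lemma LowerOrder.localLaplacian (hφ : φ ∈ atlas (EuclSp n) M) {m : ℕ}
    {A : (EuclSp n → ℝ) → EuclSp n → ℝ} (hA : LowerOrder φ.target m A) :
    LowerOrder φ.target (m + 2) fun f => localLaplacian g φ (A f) := by
  have hU := φ.open_target
  refine LowerOrder.congr ((LowerOrder.sum Finset.univ fun i _ => LowerOrder.sum Finset.univ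
    fun j _ => ((hA.pderiv hU j).pderiv hU i).smul (contDiffOn_gramInv g hφ i j).neg).add
    (LowerOrder.sum Finset.univ fun j _ => ((hA.pderiv hU j).smul
      (contDiffOn_laplacianDrift g hφ j)).mono (Nat.le_succ _))) ?_
  intro f hf y hy
  rw [localLaplacian_eq g hφ (hA.contDiffOn hU hf) hy]

/-- If the leading part of `A` is `∑ a_x ∂^{α_x}`, then the leading part of `Δ_g ∘ A` is
`-∑ g^{ij} a_x ∂_i ∂_j ∂^{α_x}`. -/
lemma LowerOrder.localLaplacian_sub (hφ : φ ∈ atlas (EuclSp n) M) {m : ℕ} {ι : Type*} [Fintype ι]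
    {a : ι → EuclSp n → ℝ} (ha : ∀ x, ContDiffOn ℝ ∞ (a x) φ.target) {α : ι → List (Fin n)}
    (hα : ∀ x, (α x).length = m) {A : (EuclSp n → ℝ) → EuclSp n → ℝ}
    (hA : LowerOrder φ.target m fun f y => A f y - ∑ x, a x y * RiemSobolev.multiDeriv (α x) f y) :
    LowerOrder φ.target (m + 2) fun f y => RiemSobolev.localLaplacian g φ (A f) y -
      ∑ x, ∑ i, ∑ j, -gramInv g φ y i j * a x y * RiemSobolev.multiDeriv (i :: j :: α x) f y := by
  have hU := φ.open_target
  have hmono : ∀ x, LowerOrder φ.target (m + 1) fun f y =>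
      a x y * RiemSobolev.multiDeriv (α x) f y := fun x => .monomial _ _ (ha x) (by simp [hα])
  have hsum := LowerOrder.sum Finset.univ fun x _ => hmono x
  have hlap : ∀ x, LowerOrder φ.target (m + 2) fun f y => RiemSobolev.localLaplacian g φ
      (fun z => a x z * RiemSobolev.multiDeriv (α x) f z) y -
      ∑ i, ∑ j, -gramInv g φ y i j * a x y * RiemSobolev.multiDeriv (i :: j :: α x) f y := by
    intro x
    have h1 : ∀ i j, LowerOrder φ.target (m + 2) fun f y => -gramInv g φ y i j *
        (RiemSobolev.pderiv i (fun z => RiemSobolev.pderiv j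
            (fun z => a x z * RiemSobolev.multiDeriv (α x) f z) z
            - a x z * RiemSobolev.multiDeriv (j :: α x) f z) y +
          (RiemSobolev.pderiv i (fun z => a x z * RiemSobolev.multiDeriv (j :: α x) f z) y
            - a x y * RiemSobolev.multiDeriv (i :: j :: α x) f y)) := fun i j =>
      (((LowerOrder.pderiv_monomial_sub (m := m + 1) hU (ha x) (by simp [hα]) j).pderiv hU i).add
        (LowerOrder.pderiv_monomial_sub hU (ha x) (by simp [hα]) i)).smul
          (contDiffOn_gramInv g hφ i j).neg
    refine ((LowerOrder.sum Finset.univ fun i _ => LowerOrder.sum Finset.univ fun j _ =>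
      h1 i j).add (LowerOrder.sum Finset.univ fun j _ => ((hmono x).pderiv hU j).smul
        (contDiffOn_laplacianDrift g hφ j))).congr ?_
    intro f hf y hy
    have h2 : ∀ i j, RiemSobolev.pderiv i (RiemSobolev.pderiv j
        (fun z => a x z * RiemSobolev.multiDeriv (α x) f z)) y =
        RiemSobolev.pderiv i (fun z => RiemSobolev.pderiv j
          (fun z => a x z * RiemSobolev.multiDeriv (α x) f z) z
          - a x z * RiemSobolev.multiDeriv (j :: α x) f z) y +
        RiemSobolev.pderiv i (fun z => a x z * RiemSobolev.multiDeriv (j :: α x) f z) y := by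
      intro i j
      have hd := (ha x).mul (contDiffOn_multiDeriv hU hf (j :: α x))
      exact pderiv_add hU ((contDiffOn_pderiv hU ((ha x).mul
        (contDiffOn_multiDeriv hU hf (α x))) j).sub hd) hd (fun z _ => by simp) i hy
    rw [localLaplacian_eq g hφ ((ha x).mul (contDiffOn_multiDeriv hU hf (α x))) hy,
      add_sub_right_comm]
    congr 1
    simp only [← Finset.sum_sub_distrib]
    refine Finset.sum_congr rfl fun i _ => Finset.sum_congr rfl fun j _ => ?_
    rw [h2]
    ring
  refine ((hA.localLaplacian g hφ).add (LowerOrder.sum Finset.univ fun x _ => hlap x)).congr ?_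
  intro f hf y hy
  rw [Finset.sum_sub_distrib, ← add_sub_assoc]
  congr 1
  -- The Laplacian is additive; this is read off from its expanded form.
  have hT : ∀ x, ContDiffOn ℝ ∞ (fun z => a x z * RiemSobolev.multiDeriv (α x) f z) φ.target :=
    fun x => (ha x).mul (contDiffOn_multiDeriv hU hf (α x))
  have hS := hsum.contDiffOn hU hf
  have hR := hA.contDiffOn hU hf
  have hAf : ∀ z ∈ φ.target, A f z = (A f z - ∑ x, a x z * RiemSobolev.multiDeriv (α x) f z) +
      ∑ x, a x z * RiemSobolev.multiDeriv (α x) f z := fun z _ => by ring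
  have hp : ∀ j, ∀ z ∈ φ.target, RiemSobolev.pderiv j (A f) z = RiemSobolev.pderiv j
      (fun z => A f z - ∑ x, a x z * RiemSobolev.multiDeriv (α x) f z) z +
      ∑ x, RiemSobolev.pderiv j (fun z => a x z * RiemSobolev.multiDeriv (α x) f z) z := by
    intro j z hz
    rw [pderiv_add hU hR hS hAf j hz, pderiv_sum hU _ (fun x _ => hT x) j hz]
  have hAs : ContDiffOn ℝ ∞ (A f) φ.target := (hR.add hS).congr hAf
  have hpp : ∀ i j, RiemSobolev.pderiv i (RiemSobolev.pderiv j (A f)) y =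
      RiemSobolev.pderiv i (RiemSobolev.pderiv j
      (fun z => A f z - ∑ x, a x z * RiemSobolev.multiDeriv (α x) f z)) y +
      ∑ x, RiemSobolev.pderiv i (RiemSobolev.pderiv j
        (fun z => a x z * RiemSobolev.multiDeriv (α x) f z)) y := by
    intro i j
    rw [pderiv_add hU (contDiffOn_pderiv hU hR j)
      (ContDiffOn.sum fun x _ => contDiffOn_pderiv hU (hT x) j) (hp j) i hy,
      pderiv_sum hU _ (fun x _ => contDiffOn_pderiv hU (hT x) j) i hy]
  rw [localLaplacian_eq g hφ hAs hy, localLaplacian_eq g hφ hR hy,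
    Finset.sum_congr rfl fun x _ => localLaplacian_eq g hφ (hT x) hy]
  simp only [hpp, hp _ y hy, mul_add, Finset.sum_add_distrib, Finset.mul_sum]
  have e1 := Finset.sum_comm (s := (Finset.univ : Finset ι)) (t := (Finset.univ : Finset (Fin n)))
    (f := fun x j => laplacianDrift g φ j y * RiemSobolev.pderiv j
      (fun z => a x z * RiemSobolev.multiDeriv (α x) f z) y)
  have e2 : ∑ x, ∑ i, ∑ j, -gramInv g φ y i j * RiemSobolev.pderiv i (RiemSobolev.pderiv j
        (fun z => a x z * RiemSobolev.multiDeriv (α x) f z)) y =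
      ∑ i, ∑ j, ∑ x, -gramInv g φ y i j * RiemSobolev.pderiv i (RiemSobolev.pderiv j
        (fun z => a x z * RiemSobolev.multiDeriv (α x) f z)) y := by
    rw [Finset.sum_comm]
    exact Finset.sum_congr rfl fun i _ => Finset.sum_comm
  rw [e1, e2]
  ring

/-- In a chart, the leading part of `Δ_g^k` is
`(-1)^k g^{i_1 j_1} ⋯ g^{i_k j_k} ∂_{i_1} ⋯ ∂_{i_k} ∂_{j_1} ⋯ ∂_{j_k}`. -/
lemma lowerOrder_iterate_localLaplacian_sub (hφ : φ ∈ atlas (EuclSp n) M) (k : ℕ) :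
    LowerOrder φ.target (2 * k) fun f y => (localLaplacian g φ)^[k] f y -
      ∑ X : (Fin k → Fin n) × (Fin k → Fin n), ((-1) ^ k * ∏ s, gramInv g φ y (X.1 s) (X.2 s)) *
        multiDeriv (List.ofFn X.1 ++ List.ofFn X.2) f y := by
  induction k with
  | zero => exact LowerOrder.zero.congr fun f _ y _ => by simp [multiDeriv]
  | succ k ih =>
      have hc : ∀ X : (Fin k → Fin n) × (Fin k → Fin n), ContDiffOn ℝ ∞
          (fun y => (-1) ^ k * ∏ s, gramInv g φ y (X.1 s) (X.2 s)) φ.target := fun X =>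
        contDiffOn_const.mul (contDiffOn_prod fun s _ => contDiffOn_gramInv g hφ _ _)
      refine (LowerOrder.localLaplacian_sub g hφ hc (fun X => by simp; omega) ih).congr ?_
      intro f hf y hy
      rw [Function.iterate_succ_apply']
      congr 1
      refine (Fintype.sum_bijective
        (fun X : (Fin (k + 1) → Fin n) × (Fin (k + 1) → Fin n) =>
          ((((Fin.tail X.1, Fin.tail X.2), X.1 0), X.2 0) :
            (((Fin k → Fin n) × (Fin k → Fin n)) × Fin n) × Fin n)) ?_ _
        (fun Z => -gramInv g φ y Z.1.2 Z.2 *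
          ((-1) ^ k * ∏ s, gramInv g φ y (Z.1.1.1 s) (Z.1.1.2 s)) *
          multiDeriv (Z.1.2 :: Z.2 :: (List.ofFn Z.1.1.1 ++ List.ofFn Z.1.1.2)) f y) ?_).trans
        (by simp only [Fintype.sum_prod_type])
      · refine Function.bijective_iff_has_inverse.2
          ⟨fun X => (Fin.cons X.1.2 X.1.1.1, Fin.cons X.2 X.1.1.2), ?_, ?_⟩
        · rintro ⟨I, J⟩; simp
        · rintro ⟨⟨⟨I, J⟩, i⟩, j⟩; simp
      · rintro ⟨I, J⟩
        rw [Fin.prod_univ_succ]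
        have hp : (List.ofFn I ++ List.ofFn J).Perm
            (I 0 :: J 0 :: (List.ofFn (Fin.tail I) ++ List.ofFn (Fin.tail J))) := by
          rw [List.ofFn_succ, List.ofFn_succ, List.cons_append]
          exact List.Perm.cons _ List.perm_middle
        simp only
        rw [multiDeriv_perm φ.open_target hf hp y hy]
        simp only [Fin.tail]
        ring

lemma lowerOrder_covDeriv_sub (hφ : φ ∈ atlas (EuclSp n) M) :
    ∀ (l : ℕ) (I : Fin l → Fin n), LowerOrder φ.target l fun f y =>
      covDeriv g φ f l I y - multiDeriv (List.ofFn I) f y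
  | 0, _ => LowerOrder.zero.congr fun f _ y _ => by simp [covDeriv, multiDeriv]
  | l + 1, I => by
      have hU := φ.open_target
      have ih := lowerOrder_covDeriv_sub hφ l
      have hl : ∀ J : Fin l → Fin n, LowerOrder φ.target (l + 1) fun f y =>
          covDeriv g φ f l J y := fun J =>
        (((ih J).mono (Nat.le_succ l)).add (LowerOrder.multiDeriv (α := List.ofFn J)
          (by simp))).congr fun f _ y _ => by ring
      refine (((ih (Fin.tail I)).pderiv hU (I 0)).sub (LowerOrder.sum Finset.univ fun s _ =>
        LowerOrder.sum Finset.univ fun m _ => (hl (Function.update (Fin.tail I) s m)).smul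
          (contDiffOn_christoffel g hφ m (I 0) (Fin.tail I s)))).congr ?_
      intro f hf y hy
      have h1 : pderiv (I 0) (covDeriv g φ f l (Fin.tail I)) y = pderiv (I 0) (fun z =>
          covDeriv g φ f l (Fin.tail I) z - multiDeriv (List.ofFn (Fin.tail I)) f z) y +
          pderiv (I 0) (multiDeriv (List.ofFn (Fin.tail I)) f) y :=
        pderiv_add hU ((ih _).contDiffOn hU hf) (contDiffOn_multiDeriv hU hf _)
          (fun z _ => by ring) _ hy
      rw [covDeriv, h1, List.ofFn_succ, multiDeriv]
      simp only [Fin.tail_def]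
      ring

open scoped MatrixOrder Matrix.Norms.L2Operator in
/-- Cauchy-Schwarz inequality for tensors: `T(e_{i_1}, …, e_{i_l})² ≤ |e_{i_1}|² ⋯ |e_{i_l}|² |T|²`,
applied to `T = ∇^l f`. -/
lemma sq_covDeriv_le (hφ : φ ∈ atlas (EuclSp n) M) (l : ℕ) (f : EuclSp n → ℝ)
    (I : Fin l → Fin n) {y : EuclSp n} (hy : y ∈ φ.target) :
    covDeriv g φ f l I y ^ 2 ≤ (∏ s, gram g φ y (I s) (I s)) * covInner g φ l f f y := by
  obtain ⟨B, hB⟩ : ∃ B : Matrix (Fin n) (Fin n) ℝ, gramInv g φ y = B.transpose * B := by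
    obtain ⟨B, hB⟩ := (CStarAlgebra.nonneg_iff_eq_star_mul_self (a := gramInv g φ y)).1
      (posDef_gramInv g hφ hy).posSemidef.nonneg
    exact ⟨B, by simpa [Matrix.star_eq_conjTranspose] using hB⟩
  have hBu : IsUnit B.det := by
    have h := (posDef_gramInv g hφ hy).det_pos.ne'
    rw [hB, Matrix.det_mul] at h
    exact (right_ne_zero_of_mul h).isUnit
  have hG : gram g φ y = B⁻¹ * B⁻¹.transpose := by
    have : gram g φ y = (gramInv g φ y)⁻¹ :=
      (Matrix.nonsing_inv_nonsing_inv _ (posDef_gram g hφ hy).det_pos.ne'.isUnit).symm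
    rw [this, hB, Matrix.mul_inv_rev, Matrix.transpose_nonsing_inv]
  have hB' : ∀ i j, gramInv g φ y i j = ∑ k, B k i * B k j := fun i j => by
    rw [hB]; simp [Matrix.mul_apply]
  have hG' : ∀ i, gram g φ y i i = ∑ k, B⁻¹ i k ^ 2 := fun i => by
    rw [hG]; simp [Matrix.mul_apply, sq]
  have hI : ∀ i j, ∑ k, B⁻¹ i k * B k j = if i = j then 1 else 0 := fun i j => by
    rw [← Matrix.mul_apply, Matrix.nonsing_inv_mul _ hBu, Matrix.one_apply]
  set T := fun I => covDeriv g φ f l I y with hT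
  set S := fun K : Fin l → Fin n => ∑ J, (∏ s, B (K s) (J s)) * T J with hS
  have h1 : covInner g φ l f f y = ∑ K, S K ^ 2 := by
    unfold covInner
    simp only [hS, hB', Finset.prod_univ_sum, Fintype.piFinset_univ, Finset.prod_mul_distrib,
      Finset.sum_mul, sq, Finset.mul_sum]
    rw [Finset.sum_comm]
    conv_rhs => rw [Finset.sum_comm]
    refine Finset.sum_congr rfl fun I _ => ?_
    conv_rhs => rw [Finset.sum_comm]
    refine Finset.sum_congr rfl fun J _ => Finset.sum_congr rfl fun K _ => ?_
    ring
  have h2 : T I = ∑ K, (∏ s, B⁻¹ (I s) (K s)) * S K := by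
    simp only [hS, Finset.mul_sum]
    rw [Finset.sum_comm]
    have : ∀ J, ∑ K : Fin l → Fin n, (∏ s, B⁻¹ (I s) (K s)) * ((∏ s, B (K s) (J s)) * T J) =
        if I = J then T J else 0 := by
      intro J
      simp only [← mul_assoc, ← Finset.prod_mul_distrib, ← Finset.sum_mul]
      rw [← Fintype.piFinset_univ, ← Finset.prod_univ_sum (fun _ => Finset.univ)
        fun s k => B⁻¹ (I s) k * B k (J s)]
      simp only [hI, Finset.prod_ite_zero, Finset.mem_univ, Finset.prod_const_one, ite_mul, one_mul,
        zero_mul, true_imp_iff, funext_iff]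
    simp only [this, Finset.sum_ite_eq, Finset.mem_univ, if_true]
  have h3 : ∏ s, gram g φ y (I s) (I s) = ∑ K : Fin l → Fin n, (∏ s, B⁻¹ (I s) (K s)) ^ 2 := by
    simp only [hG', Finset.prod_univ_sum, Fintype.piFinset_univ, Finset.prod_pow]
  change T I ^ 2 ≤ _
  rw [h2, h1, h3]
  exact Finset.sum_mul_sq_le_sq_mul_sq _ _ _

/-- On a compact subset of a chart, the partial derivatives of order less than `m` are controlled by
the covariant derivatives of order less than `m`. -/
lemma exists_sum_abs_multiDeriv_le (hφ : φ ∈ atlas (EuclSp n) M) {K : Set (EuclSp n)}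
    (hK : IsCompact K) (hKU : K ⊆ φ.target) (m : ℕ) :
    ∃ C, 0 ≤ C ∧ ∀ f, ContDiffOn ℝ ∞ f φ.target → ∀ y ∈ K,
      ∑ l ∈ Finset.range m, ∑ I : Fin l → Fin n, |multiDeriv (List.ofFn I) f y| ≤
        C * ∑ l ∈ Finset.range m, √(covInner g φ l f f y) := by
  induction m with
  | zero => exact ⟨0, le_rfl, by simp⟩
  | succ m ih =>
      obtain ⟨C, hC0, hC⟩ := ih
      choose D hD0 hD using fun I : Fin m → Fin n =>
        (lowerOrder_covDeriv_sub g hφ m I).exists_bound hK hKU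
      have hgc : ∀ I : Fin m → Fin n, ContinuousOn
          (fun y => √(∏ s, gram g φ y (I s) (I s))) K := fun I =>
        (continuousOn_finsetProd _ fun s _ => (contDiffOn_gram g hφ _ _).continuousOn.mono
          hKU).sqrt
      choose A hA using fun I => hK.exists_bound_of_continuousOn (hgc I)
      refine ⟨C + ∑ I, (|A I| + D I * C), add_nonneg hC0 (Finset.sum_nonneg fun I _ =>
        add_nonneg (abs_nonneg _) (mul_nonneg (hD0 I) hC0)), fun f hf y hy => ?_⟩
      have hs := hC f hf y hy
      set e := ∑ l ∈ Finset.range m, ∑ I : Fin l → Fin n, |multiDeriv (List.ofFn I) f y|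
      set q := ∑ l ∈ Finset.range m, √(covInner g φ l f f y)
      set r := √(covInner g φ m f f y)
      have hq : 0 ≤ q := Finset.sum_nonneg fun _ _ => Real.sqrt_nonneg _
      have hr : 0 ≤ r := Real.sqrt_nonneg _
      rw [Finset.sum_range_succ, Finset.sum_range_succ, add_mul, Finset.sum_mul]
      have hI : ∀ I : Fin m → Fin n, |multiDeriv (List.ofFn I) f y| ≤
          (|A I| + D I * C) * (q + r) := by
        intro I
        have h1 : |covDeriv g φ f m I y| ≤ |A I| * r := by
          rw [← Real.sqrt_sq_eq_abs]
          refine (Real.sqrt_le_sqrt (sq_covDeriv_le g hφ m f I (hKU hy))).trans ?_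
          rw [Real.sqrt_mul' _ (covInner_self_nonneg g hφ m f (hKU hy))]
          refine mul_le_mul_of_nonneg_right ?_ hr
          exact (le_abs_self _).trans ((hA I y hy).trans (le_abs_self _))
        have h2 := (hD I f hf y hy).trans (mul_le_mul_of_nonneg_left hs (hD0 I))
        have h3 : |multiDeriv (List.ofFn I) f y| ≤ |covDeriv g φ f m I y| +
            |covDeriv g φ f m I y - multiDeriv (List.ofFn I) f y| := by
          have := abs_sub_abs_le_abs_sub (multiDeriv (List.ofFn I) f y) (covDeriv g φ f m I y)
          rw [abs_sub_comm] at this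
          linarith
        have h4 : 0 ≤ |A I| * q := by positivity
        have h5 : 0 ≤ D I * C * r := by have := hD0 I; positivity
        nlinarith
      have := Finset.sum_le_sum fun I (_ : I ∈ Finset.univ) => hI I
      have h6 : 0 ≤ C * r := by positivity
      linarith

end LeadingParts

/-! ### Change of charts -/

section ChangeOfCharts

variable {n : ℕ} {M : Type*} [TopologicalSpace M]

/-- The matrix `(∂_i τ^a)_{a i}` of the differential of `τ` at `y`. -/
def jacobian (τ : EuclSp n → EuclSp n) (y : EuclSp n) : Matrix (Fin n) (Fin n) ℝ :=
  Matrix.of fun a i => fderiv ℝ τ y (EuclideanSpace.single i 1) a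

lemma det_fderiv_eq (τ : EuclSp n → EuclSp n) (y : EuclSp n) :
    (fderiv ℝ τ y).det = (jacobian τ y).det := by
  rw [ContinuousLinearMap.det,
    ← LinearMap.det_toMatrix (EuclideanSpace.basisFun (Fin n) ℝ).toBasis]
  rfl

lemma fderiv_single_eq_sum (τ : EuclSp n → EuclSp n) (y : EuclSp n) (i : Fin n) :
    fderiv ℝ τ y (EuclideanSpace.single i 1) =
      ∑ a, jacobian τ y a i • (EuclideanSpace.single a (1 : ℝ) : EuclSp n) := by
  have := (EuclideanSpace.basisFun (Fin n) ℝ).sum_repr (fderiv ℝ τ y (EuclideanSpace.single i 1))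
  simpa [jacobian] using this.symm

lemma pderiv_comp {τ : EuclSp n → EuclSp n} {f : EuclSp n → ℝ} {y : EuclSp n}
    (hτ : DifferentiableAt ℝ τ y) (hf : DifferentiableAt ℝ f (τ y)) (i : Fin n) :
    pderiv i (fun z => f (τ z)) y = ∑ a, jacobian τ y a i * pderiv a f (τ y) := by
  have h : fderiv ℝ (fun z => f (τ z)) y = (fderiv ℝ f (τ y)).comp (fderiv ℝ τ y) :=
    fderiv_comp y hf hτ
  simp only [pderiv, h, ContinuousLinearMap.comp_apply, fderiv_single_eq_sum, map_sum, map_smul,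
    smul_eq_mul]

variable {φ ψ : OpenPartialHomeomorph M (EuclSp n)}

lemma symm_eq_symm_transition {y : EuclSp n} (hy : y ∈ (φ.symm.trans ψ).source) :
    ψ.symm ((φ.symm.trans ψ) y) = φ.symm y := by
  rw [OpenPartialHomeomorph.trans_source] at hy
  exact ψ.left_inv hy.2

lemma transition_source_subset : (φ.symm.trans ψ).source ⊆ φ.target := fun _ hy => by
  rw [OpenPartialHomeomorph.trans_source] at hy
  exact hy.1

lemma transition_target_subset : (φ.symm.trans ψ).target ⊆ ψ.target := fun _ hy => by
  rw [OpenPartialHomeomorph.trans_target] at hy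
  exact hy.1

/-- Change of variables under a transition map. -/
lemma setIntegral_transition_target
    (hτ : ContDiffOn ℝ ∞ (φ.symm.trans ψ) (φ.symm.trans ψ).source) (F : EuclSp n → ℝ) :
    ∫ z in (φ.symm.trans ψ).target, F z = ∫ y in (φ.symm.trans ψ).source,
      |(jacobian (φ.symm.trans ψ) y).det| * F ((φ.symm.trans ψ) y) := by
  set τ := φ.symm.trans ψ
  rw [← τ.image_source_eq_target, MeasureTheory.integral_image_eq_integral_abs_det_fderiv_smul
    MeasureTheory.volume τ.open_source.measurableSet (f' := fderiv ℝ τ) _ τ.injOn]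
  · simp only [det_fderiv_eq, smul_eq_mul]
  · intro y hy
    exact ((hτ.contDiffAt (τ.open_source.mem_nhds hy)).differentiableAt
      (by simp)).hasFDerivAt.hasFDerivWithinAt

variable [ChartedSpace (EuclSp n) M] [IsManifold (𝓡 n) ∞ M] (g : RiemMetric n M)

lemma contDiffOn_transition (hφ : φ ∈ atlas (EuclSp n) M) (hψ : ψ ∈ atlas (EuclSp n) M) :
    ContDiffOn ℝ ∞ (φ.symm.trans ψ) (φ.symm.trans ψ).source := by
  rw [← contMDiffOn_iff_contDiffOn]
  refine (contMDiffOn_of_mem_maximalAtlas (n := ∞)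
    (IsManifold.subset_maximalAtlas (I := 𝓡 n) hψ)).comp ((contMDiffOn_symm_of_mem_maximalAtlas
      (n := ∞) (IsManifold.subset_maximalAtlas (I := 𝓡 n) hφ)).mono transition_source_subset) ?_
  intro y hy
  rw [OpenPartialHomeomorph.trans_source] at hy
  exact hy.2

lemma coordVec_transition (hφ : φ ∈ atlas (EuclSp n) M) (hψ : ψ ∈ atlas (EuclSp n) M) {y : EuclSp n}
    (hy : y ∈ (φ.symm.trans ψ).source) (i : Fin n) :
    (coordVec φ i y : EuclSp n) = ∑ a, jacobian (φ.symm.trans ψ) y a i •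
      (coordVec ψ a ((φ.symm.trans ψ) y) : EuclSp n) := by
  set τ := φ.symm.trans ψ with hτ
  have hd : DifferentiableAt ℝ τ y :=
    ((contDiffOn_transition hφ hψ).contDiffAt (τ.open_source.mem_nhds hy)).differentiableAt
      (by simp)
  have hz : τ y ∈ ψ.target := transition_target_subset (τ.map_source hy)
  have h1 : φ.symm =ᶠ[nhds y] ψ.symm ∘ τ :=
    Filter.eventuallyEq_of_mem (τ.open_source.mem_nhds hy)
      fun z hz => (symm_eq_symm_transition hz).symm
  have h2 : mfderiv (𝓡 n) (𝓡 n) φ.symm y =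
      (mfderiv (𝓡 n) (𝓡 n) ψ.symm (τ y)).comp (mfderiv (𝓡 n) (𝓡 n) τ y) := by
    rw [h1.mfderiv_eq]
    exact mfderiv_comp y ((mdifferentiable_of_mem_atlas (I := 𝓡 n) hψ).mdifferentiableAt_symm hz)
      hd.mdifferentiableAt
  have h3 : coordVec φ i y = mfderiv (𝓡 n) (𝓡 n) ψ.symm (τ y)
      (fderiv ℝ τ y (EuclideanSpace.single i 1)) := by
    unfold coordVec
    rw [h2]
    erw [mfderiv_eq_fderiv]
    rfl
  rw [h3, fderiv_single_eq_sum]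
  erw [map_sum]
  refine Finset.sum_congr rfl fun a _ => ?_
  erw [map_smul]
  rfl

lemma gram_transition (hφ : φ ∈ atlas (EuclSp n) M) (hψ : ψ ∈ atlas (EuclSp n) M) {y : EuclSp n}
    (hy : y ∈ (φ.symm.trans ψ).source) :
    gram g φ y = (jacobian (φ.symm.trans ψ) y).transpose * gram g ψ ((φ.symm.trans ψ) y) *
      jacobian (φ.symm.trans ψ) y := by
  have hp := symm_eq_symm_transition hy
  -- All tangent spaces are the model space, so that the base point can be rewritten.
  let G : M → EuclSp n →L[ℝ] EuclSp n →L[ℝ] ℝ := fun p => g.inner p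
  have hG : ∀ p (s : Fin n → ℝ) (v : Fin n → EuclSp n) (t : Fin n → ℝ) (w : Fin n → EuclSp n),
      G p (∑ a, s a • v a) (∑ b, t b • w b) = ∑ b, ∑ a, s a * t b * G p (v a) (w b) := by
    intro p s v t w
    simp only [map_sum, map_smul, sum_apply, smul_apply,
      smul_eq_mul, Finset.mul_sum]
    exact Finset.sum_congr rfl fun b _ => Finset.sum_congr rfl fun a _ => by ring
  ext i j
  have h1 : gram g φ y i j = G (φ.symm y) (coordVec φ i y) (coordVec φ j y) := rfl
  have h2 : ∀ a b, gram g ψ ((φ.symm.trans ψ) y) a b = G (ψ.symm ((φ.symm.trans ψ) y))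
    (coordVec ψ a ((φ.symm.trans ψ) y)) (coordVec ψ b ((φ.symm.trans ψ) y)) := fun _ _ => rfl
  rw [h1, coordVec_transition hφ hψ hy, coordVec_transition hφ hψ hy]
  refine (hG (φ.symm y) (fun a => jacobian (φ.symm.trans ψ) y a i) _
    (fun b => jacobian (φ.symm.trans ψ) y b j) _).trans ?_
  simp only [Matrix.mul_apply, Matrix.transpose_apply, h2, hp, Finset.sum_mul]
  refine Finset.sum_congr rfl fun b _ => Finset.sum_congr rfl fun a _ => ?_
  ring

lemma volDensity_transition (hφ : φ ∈ atlas (EuclSp n) M) (hψ : ψ ∈ atlas (EuclSp n) M)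
    {y : EuclSp n} (hy : y ∈ (φ.symm.trans ψ).source) :
    volDensity g φ y = |(jacobian (φ.symm.trans ψ) y).det| *
      volDensity g ψ ((φ.symm.trans ψ) y) := by
  unfold volDensity
  rw [gram_transition g hφ hψ hy, Matrix.det_mul, Matrix.det_mul, Matrix.det_transpose,
    ← Real.sqrt_sq_eq_abs, ← Real.sqrt_mul (sq_nonneg _)]
  congr 1
  ring

lemma jacobian_mul_gramInv_mul (hφ : φ ∈ atlas (EuclSp n) M) (hψ : ψ ∈ atlas (EuclSp n) M)
    {y : EuclSp n} (hy : y ∈ (φ.symm.trans ψ).source) :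
    jacobian (φ.symm.trans ψ) y * gramInv g φ y * (jacobian (φ.symm.trans ψ) y).transpose =
      gramInv g ψ ((φ.symm.trans ψ) y) := by
  have h := gram_transition g hφ hψ hy
  have hd := (posDef_gram g hφ (transition_source_subset hy)).det_pos.ne'
  set J := jacobian (φ.symm.trans ψ) y
  have hJ : IsUnit J.det := by
    rw [h, Matrix.det_mul] at hd
    exact (right_ne_zero_of_mul hd).isUnit
  have hJt : IsUnit J.transpose.det := by rwa [Matrix.det_transpose]
  unfold gramInv
  rw [h, Matrix.mul_inv_rev, Matrix.mul_inv_rev, ← Matrix.mul_assoc, Matrix.mul_nonsing_inv _ hJ,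
    Matrix.one_mul, Matrix.mul_assoc, Matrix.nonsing_inv_mul _ hJt, Matrix.mul_one]

/-- The scalar product `g^{ij} ∂_i η ∂_j f` of two differentials. -/
def gradInner (φ : OpenPartialHomeomorph M (EuclSp n)) (η f : EuclSp n → ℝ) (y : EuclSp n) : ℝ :=
  ∑ i, ∑ j, gramInv g φ y i j * pderiv i η y * pderiv j f y

lemma gradInner_transition (hφ : φ ∈ atlas (EuclSp n) M) (hψ : ψ ∈ atlas (EuclSp n) M)
    {y : EuclSp n} (hy : y ∈ (φ.symm.trans ψ).source) {η f : EuclSp n → ℝ}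
    (hη : DifferentiableAt ℝ η ((φ.symm.trans ψ) y))
    (hf : DifferentiableAt ℝ f ((φ.symm.trans ψ) y)) :
    gradInner g φ (fun z => η ((φ.symm.trans ψ) z)) (fun z => f ((φ.symm.trans ψ) z)) y =
      gradInner g ψ η f ((φ.symm.trans ψ) y) := by
  have hd : DifferentiableAt ℝ (φ.symm.trans ψ) y := ((contDiffOn_transition hφ hψ).contDiffAt
    ((φ.symm.trans ψ).open_source.mem_nhds hy)).differentiableAt (by simp)
  unfold gradInner
  simp only [pderiv_comp hd hη, pderiv_comp hd hf, ← jacobian_mul_gramInv_mul g hφ hψ hy,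
    Matrix.mul_apply, Matrix.transpose_apply, Finset.sum_mul, Finset.mul_sum]
  -- Both sides are sums over four indices of the same terms.
  have e1 : ∀ F : Fin n → Fin n → Fin n → Fin n → ℝ,
      ∑ i, ∑ j, ∑ b, ∑ a, F i j a b = ∑ a, ∑ b, ∑ j, ∑ i, F i j a b := by
    intro F
    calc ∑ i, ∑ j, ∑ b, ∑ a, F i j a b = ∑ i, ∑ j, ∑ a, ∑ b, F i j a b :=
          Finset.sum_congr rfl fun i _ => Finset.sum_congr rfl fun j _ => Finset.sum_comm
      _ = ∑ i, ∑ a, ∑ j, ∑ b, F i j a b := Finset.sum_congr rfl fun i _ => Finset.sum_comm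
      _ = ∑ a, ∑ i, ∑ j, ∑ b, F i j a b := Finset.sum_comm
      _ = ∑ a, ∑ i, ∑ b, ∑ j, F i j a b :=
          Finset.sum_congr rfl fun a _ => Finset.sum_congr rfl fun i _ => Finset.sum_comm
      _ = ∑ a, ∑ b, ∑ i, ∑ j, F i j a b := Finset.sum_congr rfl fun a _ => Finset.sum_comm
      _ = ∑ a, ∑ b, ∑ j, ∑ i, F i j a b :=
          Finset.sum_congr rfl fun a _ => Finset.sum_congr rfl fun b _ => Finset.sum_comm
  rw [e1]
  refine Finset.sum_congr rfl fun a _ => Finset.sum_congr rfl fun b _ =>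
    Finset.sum_congr rfl fun j _ => Finset.sum_congr rfl fun i _ => ?_
  ring

/-- The weak form of the Laplacian: Green's formula in a chart. -/
lemma integral_mul_localLaplacian (hφ : φ ∈ atlas (EuclSp n) M) {η f : EuclSp n → ℝ}
    (hη : IsWeight φ.target η) (hf : ContDiffOn ℝ ∞ f φ.target) :
    ∫ y, η y * (volDensity g φ y * localLaplacian g φ f y) =
      ∫ y, volDensity g φ y * gradInner g φ η f y := by
  have hU := φ.open_target
  set X : Fin n → EuclSp n → ℝ := fun i z =>
    volDensity g φ z * ∑ j, gramInv g φ z i j * pderiv j f z with hX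
  have hXs : ∀ i, ContDiffOn ℝ ∞ (X i) φ.target := fun i => (contDiffOn_volDensity g hφ).mul
    (ContDiffOn.sum fun j _ => (contDiffOn_gramInv g hφ i j).mul (contDiffOn_pderiv hU hf j))
  have h1 : ∀ y, η y * (volDensity g φ y * localLaplacian g φ f y) =
      -∑ i, η y * pderiv i (X i) y := by
    intro y
    by_cases hy : y ∈ φ.target
    · have := (volDensity_pos g hφ hy).ne'
      rw [← Finset.mul_sum]
      change η y * (volDensity g φ y * -((volDensity g φ y)⁻¹ * ∑ i, pderiv i (X i) y)) = _
      field_simp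
    · have : η y = 0 := image_eq_zero_of_notMem_tsupport fun h => hy (hη.subset h)
      simp [this]
  have h2 : ∀ y, volDensity g φ y * gradInner g φ η f y = ∑ i, pderiv i η y * X i y := by
    intro y
    simp only [gradInner, hX, Finset.mul_sum]
    refine Finset.sum_congr rfl fun i _ => Finset.sum_congr rfl fun j _ => ?_
    ring
  simp only [h1, h2]
  rw [MeasureTheory.integral_neg, MeasureTheory.integral_finsetSum _ fun i _ =>
      (hη.mul hU (contDiffOn_pderiv hU (hXs i) i)).integrable,
    MeasureTheory.integral_finsetSum _ fun i _ => ((hη.pderiv i).mul hU (hXs i)).integrable,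
    ← Finset.sum_neg_distrib]
  exact Finset.sum_congr rfl fun i _ => (hη.integral_pderiv_mul hU (hXs i) i).symm

/-- A test function on the overlap of two charts, expressed in the other chart, is a test
function. -/
lemma IsWeight.transition (hφ : φ ∈ atlas (EuclSp n) M) (hψ : ψ ∈ atlas (EuclSp n) M)
    {η : EuclSp n → ℝ} (hη : IsWeight (φ.symm.trans ψ).source η) :
    IsWeight (φ.symm.trans ψ).target
      ((φ.symm.trans ψ).target.indicator fun z => η ((φ.symm.trans ψ).symm z)) := by
  set τ := φ.symm.trans ψ with hτ
  have hK : IsCompact (τ '' tsupport η) :=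
    hη.compact.isCompact.image_of_continuousOn (τ.continuousOn.mono hη.subset)
  have hKt : τ '' tsupport η ⊆ τ.target := by
    rintro _ ⟨y, hy, rfl⟩
    exact τ.map_source (hη.subset hy)
  have hsupp : Function.support (τ.target.indicator fun z => η (τ.symm z)) ⊆ τ '' tsupport η := by
    intro z hz
    have hz' : z ∈ τ.target := Set.mem_of_indicator_ne_zero hz
    rw [Function.mem_support, Set.indicator_of_mem hz'] at hz
    exact ⟨τ.symm z, subset_tsupport _ hz, τ.right_inv hz'⟩
  have hts : tsupport (τ.target.indicator fun z => η (τ.symm z)) ⊆ τ '' tsupport η :=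
    closure_minimal hsupp hK.isClosed
  have hsm : ContDiffOn ℝ ∞ τ.symm τ.target := contDiffOn_transition hψ hφ
  refine ⟨contDiff_of_contDiffOn_of_tsupport_subset τ.open_target ?_ (hts.trans hKt),
    hK.of_isClosed_subset (isClosed_tsupport _) hts, hts.trans hKt⟩
  exact (hη.contDiff.comp_contDiffOn hsm).congr fun z hz => Set.indicator_of_mem hz _

lemma IsWeight.mono {U V : Set (EuclSp n)} {w : EuclSp n → ℝ} (hw : IsWeight U w) (h : U ⊆ V) :
    IsWeight V w := ⟨hw.contDiff, hw.compact, hw.subset.trans h⟩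

/-- The expression of the Laplacian does not depend on the chart. Green's formula and the change of
variables formula show that both sides have the same integrals against test functions. -/
lemma localLaplacian_transition (hφ : φ ∈ atlas (EuclSp n) M) (hψ : ψ ∈ atlas (EuclSp n) M)
    {f h : EuclSp n → ℝ} (hf : ContDiffOn ℝ ∞ f φ.target) (hh : ContDiffOn ℝ ∞ h ψ.target)
    (hfh : ∀ y ∈ (φ.symm.trans ψ).source, f y = h ((φ.symm.trans ψ) y)) :
    ∀ y ∈ (φ.symm.trans ψ).source,
      localLaplacian g φ f y = localLaplacian g ψ h ((φ.symm.trans ψ) y) := by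
  set τ := φ.symm.trans ψ with hτ
  have hV := τ.open_source
  have hτs : ContDiffOn ℝ ∞ τ τ.source := contDiffOn_transition hφ hψ
  have hsub : τ.source ⊆ φ.target := transition_source_subset
  have hsub' : τ.target ⊆ ψ.target := transition_target_subset
  have hLc : ∀ (χ : OpenPartialHomeomorph M (EuclSp n)) (f : EuclSp n → ℝ),
      χ ∈ atlas (EuclSp n) M → ContDiffOn ℝ ∞ f χ.target →
      ContinuousOn (localLaplacian g χ f) χ.target := fun χ f hχ hf =>
    ((LowerOrder.localLaplacian g hχ (LowerOrder.multiDeriv (α := []) (m := 1)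
      (by simp))).contDiffOn χ.open_target hf).continuousOn
  set F : EuclSp n → ℝ := fun y =>
    volDensity g φ y * (localLaplacian g φ f y - localLaplacian g ψ h (τ y)) with hF
  have hvol := (contDiffOn_volDensity g hφ).continuousOn.mono hsub
  have hc1 : ContinuousOn (fun y => localLaplacian g ψ h (τ y)) τ.source :=
    (hLc ψ h hψ hh).comp hτs.continuousOn fun y hy => hsub' (τ.map_source hy)
  have hc2 := (hLc φ f hφ hf).mono hsub
  have hFc : ContinuousOn F τ.source := hvol.mul (hc2.sub hc1)
  have hint : ∀ η : EuclSp n → ℝ, ContDiff ℝ ∞ η → HasCompactSupport η → tsupport η ⊆ τ.source →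
      ∫ y, η y • F y = 0 := by
    intro η h1 h2 h3
    have hη : IsWeight τ.source η := ⟨h1, h2, h3⟩
    set η' := τ.target.indicator fun z => η (τ.symm z) with hη'
    have hw' : IsWeight τ.target η' := hη.transition hφ hψ
    have hηz : ∀ y, y ∉ τ.source → η y = 0 := fun y hy =>
      image_eq_zero_of_notMem_tsupport fun h => hy (h3 h)
    have hηz' : ∀ y, y ∉ τ.target → η' y = 0 := fun y hy => Set.indicator_of_notMem hy _
    have hηeq : ∀ y ∈ τ.source, η y = η' (τ y) := fun y hy => by
      rw [hη', Set.indicator_of_mem (τ.map_source hy), τ.left_inv hy]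
    have hgrad : ∀ y ∈ τ.source, gradInner g φ η f y = gradInner g ψ η' h (τ y) := by
      intro y hy
      rw [← gradInner_transition g hφ hψ hy (hw'.contDiff.differentiable (by simp) _)
        ((hh.contDiffAt (ψ.open_target.mem_nhds (hsub' (τ.map_source hy)))).differentiableAt
          (by simp))]
      unfold gradInner
      refine Finset.sum_congr rfl fun i _ => Finset.sum_congr rfl fun j _ => ?_
      rw [pderiv_congr hV hηeq i hy, pderiv_congr hV hfh j hy]
    have key : ∫ y, η y * (volDensity g φ y * localLaplacian g φ f y) =
        ∫ y, η y * (volDensity g φ y * localLaplacian g ψ h (τ y)) := by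
      calc ∫ y, η y * (volDensity g φ y * localLaplacian g φ f y)
          = ∫ y, volDensity g φ y * gradInner g φ η f y :=
            integral_mul_localLaplacian g hφ (hη.mono hsub) hf
        _ = ∫ y in τ.source, volDensity g φ y * gradInner g φ η f y := by
            refine (MeasureTheory.setIntegral_eq_integral_of_forall_compl_eq_zero ?_).symm
            intro y hy
            have : ∀ i, pderiv i η y = 0 := fun i =>
              image_eq_zero_of_notMem_tsupport fun h => hy ((hη.pderiv i).subset h)
            simp [gradInner, this]
        _ = ∫ y in τ.source, |(jacobian τ y).det| *
              (volDensity g ψ (τ y) * gradInner g ψ η' h (τ y)) := by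
            refine MeasureTheory.setIntegral_congr_fun hV.measurableSet fun y hy => ?_
            rw [hgrad y hy, volDensity_transition g hφ hψ hy, mul_assoc]
        _ = ∫ z in τ.target, volDensity g ψ z * gradInner g ψ η' h z :=
            (setIntegral_transition_target hτs
              fun z => volDensity g ψ z * gradInner g ψ η' h z).symm
        _ = ∫ z, volDensity g ψ z * gradInner g ψ η' h z := by
            refine MeasureTheory.setIntegral_eq_integral_of_forall_compl_eq_zero ?_
            intro y hy
            have : ∀ i, pderiv i η' y = 0 := fun i =>
              image_eq_zero_of_notMem_tsupport fun h => hy ((hw'.pderiv i).subset h)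
            simp [gradInner, this]
        _ = ∫ z, η' z * (volDensity g ψ z * localLaplacian g ψ h z) :=
            (integral_mul_localLaplacian g hψ (hw'.mono hsub') hh).symm
        _ = ∫ z in τ.target, η' z * (volDensity g ψ z * localLaplacian g ψ h z) :=
            (MeasureTheory.setIntegral_eq_integral_of_forall_compl_eq_zero
              fun y hy => by rw [hηz' y hy, zero_mul]).symm
        _ = ∫ y in τ.source, |(jacobian τ y).det| *
              (η' (τ y) * (volDensity g ψ (τ y) * localLaplacian g ψ h (τ y))) :=
            setIntegral_transition_target hτs
              fun z => η' z * (volDensity g ψ z * localLaplacian g ψ h z)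
        _ = ∫ y in τ.source, η y * (volDensity g φ y * localLaplacian g ψ h (τ y)) := by
            refine MeasureTheory.setIntegral_congr_fun hV.measurableSet fun y hy => ?_
            rw [hηeq y hy, volDensity_transition g hφ hψ hy]
            ring
        _ = ∫ y, η y * (volDensity g φ y * localLaplacian g ψ h (τ y)) :=
            MeasureTheory.setIntegral_eq_integral_of_forall_compl_eq_zero
              fun y hy => by rw [hηz y hy, zero_mul]
    have hi : ∀ G : EuclSp n → ℝ, ContinuousOn G τ.source →
        MeasureTheory.Integrable fun y => η y * (volDensity g φ y * G y) := by
      intro G hG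
      have hc : ContinuousOn (fun y => η y * (volDensity g φ y * G y)) (tsupport η) :=
        (h1.continuous.continuousOn.mul (hvol.mul hG)).mono h3
      refine (hc.integrableOn_compact h2.isCompact).integrable_of_forall_notMem_eq_zero ?_
      intro y hy
      rw [image_eq_zero_of_notMem_tsupport hy, zero_mul]
    have e : ∀ y, η y • F y = η y * (volDensity g φ y * localLaplacian g φ f y) -
        η y * (volDensity g φ y * localLaplacian g ψ h (τ y)) := fun y => by
      simp only [hF, smul_eq_mul]; ring
    simp only [e]
    rw [MeasureTheory.integral_sub (hi _ hc2) (hi _ hc1), key, sub_self]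
  have hae := hV.ae_eq_zero_of_integral_contDiff_smul_eq_zero
    (hFc.locallyIntegrableOn hV.measurableSet) hint
  have hzero : Set.EqOn F (fun _ => 0) τ.source :=
    MeasureTheory.Measure.eqOn_open_of_ae_eq (μ := MeasureTheory.volume)
      ((MeasureTheory.ae_restrict_iff' hV.measurableSet).2 hae) hV hFc continuousOn_const
  intro y hy
  have := hzero hy
  simp only [hF] at this
  rcases mul_eq_zero.1 this with h0 | h0
  · exact absurd h0 (volDensity_pos g hφ (hsub hy)).ne'
  · exact sub_eq_zero.1 h0

end ChangeOfCharts

/-! ### The Laplace-Beltrami operator in an arbitrary chart -/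

section Laplacian

variable {n : ℕ} {M : Type*} [TopologicalSpace M] [ChartedSpace (EuclSp n) M]
  [IsManifold (𝓡 n) ∞ M] (g : RiemMetric n M) {φ : OpenPartialHomeomorph M (EuclSp n)}

lemma contDiffOn_comp_chart_symm (hφ : φ ∈ atlas (EuclSp n) M) {u : M → ℝ}
    (hu : ContMDiff (𝓡 n) 𝓘(ℝ, ℝ) ∞ u) : ContDiffOn ℝ ∞ (u ∘ φ.symm) φ.target :=
  contDiffOn_comp_symm hφ ⟨u, hu⟩

lemma laplaceBeltrami_symm (hφ : φ ∈ atlas (EuclSp n) M) {u : M → ℝ}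
    (hu : ContMDiff (𝓡 n) 𝓘(ℝ, ℝ) ∞ u) {y : EuclSp n} (hy : y ∈ φ.target) :
    laplaceBeltrami g u (φ.symm y) = localLaplacian g φ (u ∘ φ.symm) y := by
  set ψ := chartAt (EuclSp n) (φ.symm y)
  have hψ : ψ ∈ atlas (EuclSp n) M := chart_mem_atlas _ _
  have hy' : y ∈ (φ.symm.trans ψ).source := by
    rw [OpenPartialHomeomorph.trans_source]
    exact ⟨hy, mem_chart_source _ _⟩
  refine (localLaplacian_transition g hφ hψ (contDiffOn_comp_chart_symm hφ hu)
    (contDiffOn_comp_chart_symm hψ hu) (fun z hz => ?_) y hy').symm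
  simp only [Function.comp_apply]
  rw [symm_eq_symm_transition hz]

lemma contMDiff_laplaceBeltrami {u : M → ℝ} (hu : ContMDiff (𝓡 n) 𝓘(ℝ, ℝ) ∞ u) :
    ContMDiff (𝓡 n) 𝓘(ℝ, ℝ) ∞ (laplaceBeltrami g u) := by
  intro p
  set φ := chartAt (EuclSp n) p
  have hφ : φ ∈ atlas (EuclSp n) M := chart_mem_atlas _ _
  have h1 : ContDiffOn ℝ ∞ (localLaplacian g φ (u ∘ φ.symm)) φ.target :=
    (LowerOrder.localLaplacian g hφ (LowerOrder.multiDeriv (α := []) (m := 1)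
      (by simp))).contDiffOn φ.open_target (contDiffOn_comp_chart_symm hφ hu)
  have h2 : ContMDiffOn (𝓡 n) 𝓘(ℝ, ℝ) ∞ (fun q => localLaplacian g φ (u ∘ φ.symm) (φ q))
      φ.source :=
    h1.contMDiffOn.comp (contMDiffOn_of_mem_maximalAtlas (n := ∞)
      (IsManifold.subset_maximalAtlas (I := 𝓡 n) hφ)) fun q hq => φ.map_source hq
  refine (h2.congr fun q hq => ?_).contMDiffAt (φ.open_source.mem_nhds (mem_chart_source _ p))
  rw [← laplaceBeltrami_symm g hφ hu (φ.map_source hq), φ.left_inv hq]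

lemma contMDiff_iterate_laplaceBeltrami {u : M → ℝ} (hu : ContMDiff (𝓡 n) 𝓘(ℝ, ℝ) ∞ u) (k : ℕ) :
    ContMDiff (𝓡 n) 𝓘(ℝ, ℝ) ∞ ((laplaceBeltrami g)^[k] u) := by
  induction k with
  | zero => exact hu
  | succ k ih =>
      rw [Function.iterate_succ_apply']
      exact contMDiff_laplaceBeltrami g ih

lemma iterate_laplaceBeltrami_symm (hφ : φ ∈ atlas (EuclSp n) M) {u : M → ℝ}
    (hu : ContMDiff (𝓡 n) 𝓘(ℝ, ℝ) ∞ u) (k : ℕ) : ∀ y ∈ φ.target,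
    (laplaceBeltrami g)^[k] u (φ.symm y) = (localLaplacian g φ)^[k] (u ∘ φ.symm) y := by
  induction k with
  | zero => exact fun _ _ => rfl
  | succ k ih =>
      intro y hy
      rw [Function.iterate_succ_apply', Function.iterate_succ_apply',
        laplaceBeltrami_symm g hφ (contMDiff_iterate_laplaceBeltrami g hu k) hy]
      exact localLaplacian_congr g (fun z hz => ih z hz) y hy

end Laplacian

/-! ### Partial derivatives in charts are controlled by the Sobolev norms -/

section ChartBounds

variable {n : ℕ} {M : Type*} [TopologicalSpace M] [ChartedSpace (EuclSp n) M]
  [IsManifold (𝓡 n) ∞ M] (g : RiemMetric n M) {φ ψ : OpenPartialHomeomorph M (EuclSp n)}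

/-- The partial derivatives of a function in one chart are controlled, on a compact subset of the
overlap, by its covariant derivatives in another chart. -/
lemma exists_sq_multiDeriv_le_covInner (hφ : φ ∈ atlas (EuclSp n) M) (hψ : ψ ∈ atlas (EuclSp n) M)
    {K : Set (EuclSp n)} (hK : IsCompact K) (hKs : K ⊆ (φ.symm.trans ψ).source) (m : ℕ) :
    ∃ C, 0 ≤ C ∧ ∀ u : SmoothFun n M, ∀ α : List (Fin n), α.length ≤ m → ∀ y ∈ K,
      multiDeriv α (u ∘ φ.symm) y ^ 2 ≤ C * ∑ l ∈ Finset.range (m + 1),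
        covInner g ψ l (u ∘ ψ.symm) (u ∘ ψ.symm) ((φ.symm.trans ψ) y) := by
  set τ := φ.symm.trans ψ with hτ
  have hτs : ContDiffOn ℝ ∞ τ τ.source := contDiffOn_transition hφ hψ
  have hV := τ.open_source
  have hmt : Set.MapsTo τ τ.source ψ.target := fun y hy => transition_target_subset (τ.map_source hy)
  have hKt : IsCompact (τ '' K) := hK.image_of_continuousOn (τ.continuousOn.mono hKs)
  obtain ⟨C, hC0, hC⟩ := exists_sum_abs_multiDeriv_le g hψ hKt
    (by rintro _ ⟨y, hy, rfl⟩; exact hmt (hKs hy)) (m + 1)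
  have hDi : ∀ i : ℕ, ∃ D : ℝ, ∀ y ∈ K, ‖iteratedFDerivWithin ℝ i τ τ.source y‖ ≤ D := fun i =>
    hK.exists_bound_of_continuousOn ((hτs.continuousOn_iteratedFDerivWithin
      (by exact_mod_cast le_top) hV.uniqueDiffOn).mono hKs)
  choose D hD using hDi
  -- `1 ≤ E` gives `D i ≤ E ≤ E ^ i` for `1 ≤ i`, the form needed for the chain rule estimate.
  set E : ℝ := 1 + ∑ i ∈ Finset.range (m + 1), |D i| with hE
  have hE1 : 1 ≤ E := le_add_of_nonneg_right (Finset.sum_nonneg fun _ _ => abs_nonneg _)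
  have hDE : ∀ i ≤ m, D i ≤ E := fun i hi => (le_abs_self _).trans
    ((Finset.single_le_sum (f := fun i => |D i|) (fun _ _ => abs_nonneg _)
      (Finset.mem_range.2 (Nat.lt_succ_of_le hi))).trans (by simp [hE]))
  refine ⟨(m.factorial * C * E ^ m) ^ 2 * (m + 1 : ℕ), by positivity, fun u α hα y hy => ?_⟩
  set f := u ∘ ψ.symm
  have hf : ContDiffOn ℝ ∞ f ψ.target := contDiffOn_comp_symm hψ u
  have hy' := hKs hy
  have hfτ : ∀ z ∈ τ.source, (u ∘ φ.symm) z = (f ∘ τ) z := fun z hz => by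
    simp only [f, Function.comp_apply]
    rw [symm_eq_symm_transition hz]
  set q := ∑ l ∈ Finset.range (m + 1), √(covInner g ψ l f f (τ y))
  have hq : 0 ≤ q := Finset.sum_nonneg fun _ _ => Real.sqrt_nonneg _
  have h1 : ∀ i ≤ α.length, ‖iteratedFDerivWithin ℝ i f ψ.target (τ y)‖ ≤ C * q := by
    intro i hi
    rw [iteratedFDerivWithin_of_isOpen i ψ.open_target (hmt hy')]
    refine (norm_iteratedFDeriv_le ψ.open_target hf i (hmt hy')).trans (le_trans ?_
      (hC f hf (τ y) ⟨y, hy, rfl⟩))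
    exact Finset.single_le_sum (f := fun l => ∑ I : Fin l → Fin n,
      |multiDeriv (List.ofFn I) f (τ y)|) (fun _ _ => Finset.sum_nonneg fun _ _ => abs_nonneg _)
      (Finset.mem_range.2 (by omega))
  have h2 : ∀ i, 1 ≤ i → i ≤ α.length → ‖iteratedFDerivWithin ℝ i τ τ.source y‖ ≤ E ^ i :=
    fun i hi hi' => (hD i y hy).trans ((hDE i (by omega)).trans (le_self_pow₀ hE1 (by omega)))
  have h3 := norm_iteratedFDerivWithin_comp_le hf hτs (by exact_mod_cast le_top)
    ψ.open_target.uniqueDiffOn hV.uniqueDiffOn hmt hy' h1 h2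
  rw [iteratedFDerivWithin_of_isOpen _ hV hy'] at h3
  have h4 : |multiDeriv α (u ∘ φ.symm) y| ≤ m.factorial * C * E ^ m * q := by
    rw [multiDeriv_congr hV hfτ α y hy']
    refine (abs_multiDeriv_le hV (hf.comp hτs hmt) α hy').trans (h3.trans ?_)
    calc (α.length.factorial : ℝ) * (C * q) * E ^ α.length
        ≤ (m.factorial : ℝ) * (C * q) * E ^ m := by
          gcongr
      _ = _ := by ring
  have h5 : q ^ 2 ≤ (m + 1 : ℕ) * ∑ l ∈ Finset.range (m + 1), covInner g ψ l f f (τ y) := by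
    have := sq_sum_le_card_mul_sum_sq (s := Finset.range (m + 1))
      (f := fun l => √(covInner g ψ l f f (τ y)))
    rw [Finset.card_range] at this
    refine this.trans_eq ?_
    congr 1
    exact Finset.sum_congr rfl fun l _ =>
      Real.sq_sqrt (covInner_self_nonneg g hψ l f (hmt hy'))
  calc multiDeriv α (u ∘ φ.symm) y ^ 2 = |multiDeriv α (u ∘ φ.symm) y| ^ 2 := (sq_abs _).symm
    _ ≤ (m.factorial * C * E ^ m * q) ^ 2 := by gcongr
    _ = (m.factorial * C * E ^ m) ^ 2 * q ^ 2 := by ring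
    _ ≤ (m.factorial * C * E ^ m) ^ 2 *
        ((m + 1 : ℕ) * ∑ l ∈ Finset.range (m + 1), covInner g ψ l f f (τ y)) := by gcongr
    _ = _ := by ring

variable [T2Space M] [CompactSpace M]

lemma covL2Inner_self_nonneg (l : ℕ) (u : SmoothFun n M) : 0 ≤ covL2Inner g l u u :=
  (covL2Core g l).re_inner_nonneg u

lemma sq_covL2Norm (l : ℕ) (u : SmoothFun n M) : covL2Norm g l u ^ 2 = covL2Inner g l u u :=
  Real.sq_sqrt (covL2Inner_self_nonneg g l u)

lemma covL2Norm_le_sobolevNorm {l m : ℕ} (h : l ≤ m) (u : SmoothFun n M) :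
    covL2Norm g l u ≤ sobolevNorm g m u :=
  Finset.single_le_sum (f := fun l => covL2Norm g l u) (fun _ _ => Real.sqrt_nonneg _)
    (Finset.mem_range.2 (Nat.lt_succ_of_le h))

lemma covL2Inner_self_le {l m : ℕ} (h : l ≤ m) (u : SmoothFun n M) :
    covL2Inner g l u u ≤ sobolevNorm g m u ^ 2 := by
  rw [← sq_covL2Norm]
  exact pow_le_pow_left₀ (Real.sqrt_nonneg _) (covL2Norm_le_sobolevNorm g h u) 2

lemma sobolevNorm_mono {l m : ℕ} (h : l ≤ m) (u : SmoothFun n M) :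
    sobolevNorm g l u ≤ sobolevNorm g m u :=
  Finset.sum_le_sum_of_subset_of_nonneg (Finset.range_mono (by omega))
    fun _ _ _ => Real.sqrt_nonneg _

lemma sum_chartCenters_chartPartition (x : M) :
    ∑ q ∈ chartCenters n M, chartPartition n M q x = 1 := by
  rw [← (chartPartition n M).sum_eq_one (Set.mem_univ x)]
  refine (finsum_eq_sum_of_support_subset _ ?_).symm
  intro q hq
  simp only [chartCenters, Set.Finite.coe_toFinset, Set.mem_ofPred_eq]
  exact ⟨x, hq⟩

/-- The part of `∫ ∑_l |∇^l u|²` coming from one function of the partition of unity. -/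
lemma setIntegral_chartPartition_mul_covInner_le {q : M} (hq : q ∈ chartCenters n M) (m : ℕ)
    (u : SmoothFun n M) :
    ∫ z in (chartAt (EuclSp n) q).target,
      chartPartition n M q ((chartAt (EuclSp n) q).symm z) *
        volDensity g (chartAt (EuclSp n) q) z * ∑ l ∈ Finset.range (m + 1),
          covInner g (chartAt (EuclSp n) q) l (u ∘ (chartAt (EuclSp n) q).symm)
            (u ∘ (chartAt (EuclSp n) q).symm) z ≤ (m + 1 : ℕ) * sobolevNorm g m u ^ 2 := by
  have hs := fun p : M => contDiffOn_comp_symm (chart_mem_atlas (EuclSp n) p) u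
  simp only [Finset.mul_sum]
  rw [MeasureTheory.integral_finsetSum _ fun l _ => integrableOn_chart g q
    (continuousOn_covInner g (chart_mem_atlas _ q) (hs q) (hs q) l)]
  refine (Finset.sum_le_card_nsmul _ _ (sobolevNorm g m u ^ 2) fun l hl => ?_).trans_eq
    (by rw [Finset.card_range, nsmul_eq_mul])
  refine le_trans ?_ (covL2Inner_self_le g (Nat.lt_succ_iff.1 (Finset.mem_range.1 hl)) u)
  refine Finset.single_le_sum (f := fun p => ∫ y in (chartAt (EuclSp n) p).target,
    chartPartition n M p ((chartAt (EuclSp n) p).symm y) *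
      volDensity g (chartAt (EuclSp n) p) y * covInner g (chartAt (EuclSp n) p) l
        (u ∘ (chartAt (EuclSp n) p).symm) (u ∘ (chartAt (EuclSp n) p).symm) y) ?_ hq
  intro p _
  refine MeasureTheory.setIntegral_nonneg (chartAt (EuclSp n) p).open_target.measurableSet ?_
  intro y hy
  exact mul_nonneg (mul_nonneg ((chartPartition n M).nonneg p _) (Real.sqrt_nonneg _))
    (covInner_self_nonneg g (chart_mem_atlas _ p) l _ hy)

/-- The squared partial derivatives of order at most `m`, localised by one function of the partition
of unity, are controlled by the Sobolev norm: the integral is carried over to the chart in which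
that function lives. -/
lemma exists_setIntegral_chartPartition_mul_sq_le (hφ : φ ∈ atlas (EuclSp n) M)
    {K : Set (EuclSp n)} (hK : IsCompact K) (hKU : K ⊆ φ.target) (m : ℕ) {q : M}
    (hq : q ∈ chartCenters n M) :
    ∃ C, 0 ≤ C ∧ ∀ u : SmoothFun n M, ∀ α : List (Fin n), α.length ≤ m →
      ∫ y in K, chartPartition n M q (φ.symm y) * multiDeriv α (u ∘ φ.symm) y ^ 2 ≤
        C * sobolevNorm g m u ^ 2 := by
  set ψ := chartAt (EuclSp n) q with hψ'
  have hψ : ψ ∈ atlas (EuclSp n) M := chart_mem_atlas _ q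
  set ρ := chartPartition n M q
  set τ := φ.symm.trans ψ with hτ
  set K' := K ∩ φ.symm ⁻¹' tsupport ρ with hK'
  have hK'c : IsCompact K' := hK.of_isClosed_subset
    ((φ.continuousOn_symm.mono hKU).preimage_isClosed_of_isClosed hK.isClosed
      (isClosed_tsupport _)) Set.inter_subset_left
  have hK's : K' ⊆ τ.source := by
    intro y hy
    rw [hτ, OpenPartialHomeomorph.trans_source]
    exact ⟨hKU hy.1, tsupport_chartPartition q hy.2⟩
  obtain ⟨C₁, hC₁, h₁⟩ := exists_sq_multiDeriv_le_covInner g hφ hψ hK'c hK's m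
  obtain ⟨C₂, h₂⟩ := hK.exists_bound_of_continuousOn
    (((contDiffOn_volDensity g hφ).continuousOn.inv₀
      fun y hy => (volDensity_pos g hφ hy).ne').mono hKU)
  refine ⟨C₁ * |C₂| * (m + 1 : ℕ), by positivity, fun u α hα => ?_⟩
  have hs := contDiffOn_comp_symm hψ u
  set S : EuclSp n → ℝ := fun z => ∑ l ∈ Finset.range (m + 1),
    covInner g ψ l (u ∘ ψ.symm) (u ∘ ψ.symm) z with hS
  set H : EuclSp n → ℝ := fun z => ρ (ψ.symm z) * volDensity g ψ z * S z with hH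
  have hρ : ∀ x, 0 ≤ ρ x := (chartPartition n M).nonneg q
  have hS0 : ∀ z ∈ ψ.target, 0 ≤ S z := fun z hz =>
    Finset.sum_nonneg fun l _ => covInner_self_nonneg g hψ l _ hz
  have hH0 : ∀ z ∈ ψ.target, 0 ≤ H z := fun z hz =>
    mul_nonneg (mul_nonneg (hρ _) (Real.sqrt_nonneg _)) (hS0 z hz)
  have hHi : MeasureTheory.IntegrableOn H ψ.target := integrableOn_chart g q
    (continuousOn_finsetSum _ fun l _ => continuousOn_covInner g hψ hs hs l)
  have hτs : ContDiffOn ℝ ∞ τ τ.source := contDiffOn_transition hφ hψ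
  have hHτ : MeasureTheory.IntegrableOn (fun y => |(jacobian τ y).det| * H (τ y)) τ.source := by
    have hi := hHi.mono_set (transition_target_subset (φ := φ) (ψ := ψ))
    rw [← hτ, ← τ.image_source_eq_target,
      MeasureTheory.integrableOn_image_iff_integrableOn_abs_det_fderiv_smul MeasureTheory.volume
      τ.open_source.measurableSet (f' := fderiv ℝ τ) (fun y hy => ((hτs.contDiffAt
        (τ.open_source.mem_nhds hy)).differentiableAt
        (by simp)).hasFDerivAt.hasFDerivWithinAt) τ.injOn] at hi
    simpa only [det_fderiv_eq, smul_eq_mul] using hi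
  have hmt : ∀ y ∈ τ.source, τ y ∈ ψ.target := fun y hy =>
    transition_target_subset (τ.map_source hy)
  have hpt : ∀ y ∈ K', ρ (φ.symm y) * multiDeriv α (u ∘ φ.symm) y ^ 2 ≤
      C₁ * |C₂| * (|(jacobian τ y).det| * H (τ y)) := by
    intro y hy
    have hy' := hK's hy
    have hv := volDensity_pos g hφ (hKU hy.1)
    have e : |(jacobian τ y).det| * H (τ y) = volDensity g φ y * (ρ (φ.symm y) * S (τ y)) := by
      rw [volDensity_transition g hφ hψ hy', hH]
      simp only
      rw [symm_eq_symm_transition hy']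
      ring
    have h3 : 1 ≤ |C₂| * volDensity g φ y := by
      have h4 := (h₂ y hy.1).trans (le_abs_self _)
      rw [Real.norm_eq_abs, Pi.inv_apply, abs_of_pos (inv_pos.2 hv)] at h4
      calc (1 : ℝ) = (volDensity g φ y)⁻¹ * volDensity g φ y := (inv_mul_cancel₀ hv.ne').symm
        _ ≤ _ := mul_le_mul_of_nonneg_right h4 hv.le
    rw [e]
    have h5 := mul_le_mul_of_nonneg_left (h₁ u α hα y hy) (hρ (φ.symm y))
    have h6 : 0 ≤ C₁ * (ρ (φ.symm y) * S (τ y)) :=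
      mul_nonneg hC₁ (mul_nonneg (hρ _) (hS0 _ (hmt y hy')))
    calc _ ≤ ρ (φ.symm y) * (C₁ * S (τ y)) := h5
      _ = 1 * (C₁ * (ρ (φ.symm y) * S (τ y))) := by ring
      _ ≤ (|C₂| * volDensity g φ y) * (C₁ * (ρ (φ.symm y) * S (τ y))) :=
        mul_le_mul_of_nonneg_right h3 h6
      _ = _ := by ring
  have hcont : ContinuousOn (fun y => ρ (φ.symm y) * multiDeriv α (u ∘ φ.symm) y ^ 2) φ.target :=
    (ρ.contMDiff.continuous.comp_continuousOn φ.continuousOn_symm).mul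
      ((contDiffOn_multiDeriv φ.open_target (contDiffOn_comp_symm hφ u) α).continuousOn.pow 2)
  calc ∫ y in K, ρ (φ.symm y) * multiDeriv α (u ∘ φ.symm) y ^ 2
      = ∫ y in K', ρ (φ.symm y) * multiDeriv α (u ∘ φ.symm) y ^ 2 := by
        refine MeasureTheory.setIntegral_eq_of_subset_of_forall_sdiff_eq_zero
          hK.measurableSet Set.inter_subset_left ?_
        rintro y ⟨hy, hy'⟩
        rw [image_eq_zero_of_notMem_tsupport fun h => hy' ⟨hy, h⟩, zero_mul]
    _ ≤ ∫ y in K', C₁ * |C₂| * (|(jacobian τ y).det| * H (τ y)) :=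
        MeasureTheory.setIntegral_mono_on ((hcont.mono (Set.inter_subset_left.trans
          hKU)).integrableOn_compact hK'c) ((hHτ.mono_set hK's).const_mul _)
          hK'c.measurableSet hpt
    _ = C₁ * |C₂| * ∫ y in K', |(jacobian τ y).det| * H (τ y) :=
        MeasureTheory.integral_const_mul _ _
    _ ≤ C₁ * |C₂| * ∫ y in τ.source, |(jacobian τ y).det| * H (τ y) := by
        refine mul_le_mul_of_nonneg_left (MeasureTheory.setIntegral_mono_set hHτ ?_
          hK's.eventuallyLE) (by positivity)
        exact (MeasureTheory.ae_restrict_iff' τ.open_source.measurableSet).2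
          (.of_forall fun y hy => mul_nonneg (abs_nonneg _) (hH0 _ (hmt y hy)))
    _ = C₁ * |C₂| * ∫ z in τ.target, H z := by rw [setIntegral_transition_target hτs]
    _ ≤ C₁ * |C₂| * ∫ z in ψ.target, H z := by
        refine mul_le_mul_of_nonneg_left (MeasureTheory.setIntegral_mono_set hHi ?_
          (transition_target_subset (φ := φ) (ψ := ψ)).eventuallyLE) (by positivity)
        exact (MeasureTheory.ae_restrict_iff' ψ.open_target.measurableSet).2
          (.of_forall fun y hy => hH0 _ hy)
    _ ≤ C₁ * |C₂| * ((m + 1 : ℕ) * sobolevNorm g m u ^ 2) :=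
        mul_le_mul_of_nonneg_left (setIntegral_chartPartition_mul_covInner_le g hq m u)
          (by positivity)
    _ = _ := by ring

/-- On a compact subset of a chart, the `L²` norms of the partial derivatives of order at most `m`
are controlled by the norm of `H_m^2`. -/
lemma exists_setIntegral_sq_multiDeriv_le (hφ : φ ∈ atlas (EuclSp n) M)
    {K : Set (EuclSp n)} (hK : IsCompact K) (hKU : K ⊆ φ.target) (m : ℕ) :
    ∃ C, 0 ≤ C ∧ ∀ u : SmoothFun n M, ∀ α : List (Fin n), α.length ≤ m →
      ∫ y in K, multiDeriv α (u ∘ φ.symm) y ^ 2 ≤ C * sobolevNorm g m u ^ 2 := by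
  choose C hC0 hC using fun q : chartCenters n M =>
    exists_setIntegral_chartPartition_mul_sq_le g hφ hK hKU m q.2
  refine ⟨∑ q, C q, Finset.sum_nonneg fun q _ => hC0 q, fun u α hα => ?_⟩
  have e : ∀ y, multiDeriv α (u ∘ φ.symm) y ^ 2 = ∑ q : chartCenters n M,
      chartPartition n M (q : M) (φ.symm y) * multiDeriv α (u ∘ φ.symm) y ^ 2 := by
    intro y
    rw [← Finset.sum_mul, Finset.sum_coe_sort (chartCenters n M)
      (fun q => chartPartition n M q (φ.symm y)), sum_chartCenters_chartPartition, one_mul]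
  have hcont : ∀ q : M, ContinuousOn
      (fun y => chartPartition n M q (φ.symm y) * multiDeriv α (u ∘ φ.symm) y ^ 2) K := fun q =>
    (((chartPartition n M q).contMDiff.continuous.comp_continuousOn φ.continuousOn_symm).mul
      ((contDiffOn_multiDeriv φ.open_target
        (contDiffOn_comp_symm hφ u) α).continuousOn.pow 2)).mono hKU
  rw [MeasureTheory.integral_congr_ae (.of_forall e), MeasureTheory.integral_finsetSum _
    fun q _ => (hcont q.1).integrableOn_compact hK, Finset.sum_mul]
  exact Finset.sum_le_sum fun q _ => hC q u α hα

end ChartBounds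

/-! ### Bilinear forms in a chart and integration by parts -/

section ChartForms

open Asymptotics

variable {n : ℕ}

/-- Cauchy-Schwarz inequality on a compact set. -/
lemma abs_setIntegral_mul_le {K : Set (EuclSp n)} (hK : IsCompact K) {f h : EuclSp n → ℝ}
    (hf : ContinuousOn f K) (hh : ContinuousOn h K) :
    |∫ y in K, f y * h y| ≤ √(∫ y in K, f y ^ 2) * √(∫ y in K, h y ^ 2) := by
  have hff : MeasureTheory.IntegrableOn (fun y => f y ^ 2) K := (hf.pow 2).integrableOn_compact hK
  have hhh : MeasureTheory.IntegrableOn (fun y => h y ^ 2) K := (hh.pow 2).integrableOn_compact hK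
  have hfh : MeasureTheory.IntegrableOn (fun y => f y * h y) K :=
    (hf.mul hh).integrableOn_compact hK
  set a := ∫ y in K, f y ^ 2
  set b := ∫ y in K, f y * h y
  set c := ∫ y in K, h y ^ 2
  have hc : 0 ≤ c := MeasureTheory.integral_nonneg fun _ => sq_nonneg _
  have key : ∀ t : ℝ, 0 ≤ a * (t * t) + (2 * b) * t + c := by
    intro t
    have h1 : 0 ≤ ∫ y in K, (t * f y + h y) ^ 2 :=
      MeasureTheory.integral_nonneg fun _ => sq_nonneg _
    have h2 : ∀ y, (t * f y + h y) ^ 2 = (t * t) * f y ^ 2 + (2 * t) * (f y * h y) + h y ^ 2 :=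
      fun y => by ring
    simp only [h2] at h1
    have hi : MeasureTheory.IntegrableOn
        (fun y => t * t * f y ^ 2 + 2 * t * (f y * h y)) K :=
      (hff.const_mul (t * t)).add (hfh.const_mul (2 * t))
    rw [MeasureTheory.integral_add hi hhh,
      MeasureTheory.integral_add (hff.const_mul _) (hfh.const_mul _),
      MeasureTheory.integral_const_mul, MeasureTheory.integral_const_mul] at h1
    linarith
  have hd := discrim_le_zero key
  rw [discrim] at hd
  rw [← Real.sqrt_mul' _ hc]
  refine Real.abs_le_sqrt ?_
  linarith

variable {M : Type*} [TopologicalSpace M] [ChartedSpace (EuclSp n) M]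

/-- The bilinear form `(u, v) ↦ ∫ w A(u) B(v) dy`, where `A` and `B` act on the expressions of `u`
and `v` in the chart `φ`. -/
def chartForm (φ : OpenPartialHomeomorph M (EuclSp n)) (w : EuclSp n → ℝ)
    (A B : (EuclSp n → ℝ) → EuclSp n → ℝ) (X : SmoothFun n M × SmoothFun n M) : ℝ :=
  ∫ y, w y * A (X.1 ∘ φ.symm) y * B (X.2 ∘ φ.symm) y

variable {φ : OpenPartialHomeomorph M (EuclSp n)} {w : EuclSp n → ℝ}

lemma chartForm_congr {w' : EuclSp n → ℝ} {A A' B B' : (EuclSp n → ℝ) → EuclSp n → ℝ}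
    {X : SmoothFun n M × SmoothFun n M} (hw : IsWeight φ.target w) (hw' : IsWeight φ.target w')
    (h : ∀ y ∈ φ.target, w y * A (X.1 ∘ φ.symm) y * B (X.2 ∘ φ.symm) y =
      w' y * A' (X.1 ∘ φ.symm) y * B' (X.2 ∘ φ.symm) y) :
    chartForm φ w A B X = chartForm φ w' A' B' X := by
  refine MeasureTheory.integral_congr_ae (.of_forall fun y => ?_)
  by_cases hy : y ∈ φ.target
  · exact h y hy
  · have h1 : w y = 0 := image_eq_zero_of_notMem_tsupport fun h => hy (hw.subset h)
    have h2 : w' y = 0 := image_eq_zero_of_notMem_tsupport fun h => hy (hw'.subset h)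
    simp [h1, h2]

lemma chartForm_swap (A B : (EuclSp n → ℝ) → EuclSp n → ℝ) (X : SmoothFun n M × SmoothFun n M) :
    chartForm φ w A B X = chartForm φ w B A X.swap := by
  unfold chartForm
  congr 1
  ext y
  simp only [Prod.fst_swap, Prod.snd_swap]
  ring

variable [IsManifold (𝓡 n) ∞ M]

lemma LowerOrder.contDiffOn_comp_symm (hφ : φ ∈ atlas (EuclSp n) M) {m : ℕ}
    {A : (EuclSp n → ℝ) → EuclSp n → ℝ} (hA : LowerOrder φ.target m A) (u : SmoothFun n M) :
    ContDiffOn ℝ ∞ (A (u ∘ φ.symm)) φ.target :=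
  hA.contDiffOn φ.open_target (RiemSobolev.contDiffOn_comp_symm hφ u)

lemma chartForm_add_left (hφ : φ ∈ atlas (EuclSp n) M) (hw : IsWeight φ.target w) {m m' : ℕ}
    {A A' B : (EuclSp n → ℝ) → EuclSp n → ℝ} (hA : LowerOrder φ.target m A)
    (hA' : LowerOrder φ.target m A') (hB : LowerOrder φ.target m' B)
    (X : SmoothFun n M × SmoothFun n M) :
    chartForm φ w (fun f y => A f y + A' f y) B X = chartForm φ w A B X + chartForm φ w A' B X := by
  have hU := φ.open_target
  unfold chartForm
  have e : ∀ f h : EuclSp n → ℝ, ∀ y, w y * (A f y + A' f y) * B h y =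
      w y * A f y * B h y + w y * A' f y * B h y := fun f h y => by ring
  simp only [e]
  exact MeasureTheory.integral_add
    ((hw.mul hU (hA.contDiffOn_comp_symm hφ X.1)).mul hU
      (hB.contDiffOn_comp_symm hφ X.2)).integrable
    ((hw.mul hU (hA'.contDiffOn_comp_symm hφ X.1)).mul hU
      (hB.contDiffOn_comp_symm hφ X.2)).integrable

lemma chartForm_add_right (hφ : φ ∈ atlas (EuclSp n) M) (hw : IsWeight φ.target w) {m m' : ℕ}
    {A B B' : (EuclSp n → ℝ) → EuclSp n → ℝ} (hA : LowerOrder φ.target m A)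
    (hB : LowerOrder φ.target m' B) (hB' : LowerOrder φ.target m' B')
    (X : SmoothFun n M × SmoothFun n M) :
    chartForm φ w A (fun f y => B f y + B' f y) X = chartForm φ w A B X + chartForm φ w A B' X := by
  rw [chartForm_swap, chartForm_add_left hφ hw hB hB' hA, ← chartForm_swap, ← chartForm_swap]

/-- Integration by parts. -/
lemma chartForm_cons_left (hφ : φ ∈ atlas (EuclSp n) M) (hw : IsWeight φ.target w) (i : Fin n)
    (α β : List (Fin n)) (X : SmoothFun n M × SmoothFun n M) :
    chartForm φ w (multiDeriv (i :: α)) (multiDeriv β) X =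
      -chartForm φ w (multiDeriv α) (multiDeriv (i :: β)) X -
        chartForm φ (pderiv i w) (multiDeriv α) (multiDeriv β) X :=
  hw.integral_mul_pderiv_mul φ.open_target
    (contDiffOn_multiDeriv φ.open_target (contDiffOn_comp_symm hφ X.1) α)
    (contDiffOn_multiDeriv φ.open_target (contDiffOn_comp_symm hφ X.2) β) i

variable [T2Space M] [CompactSpace M] (g : RiemMetric n M)

/-- The function `(u, v) ↦ ‖u‖_{H_a^2} ‖v‖_{H_b^2}`, to be used as a gauge in estimates that are
uniform on `C^∞(M) × C^∞(M)`, written as `=O[⊤]`. -/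
def sobolevProd (a b : ℕ) (X : SmoothFun n M × SmoothFun n M) : ℝ :=
  sobolevNorm g a X.1 * sobolevNorm g b X.2

lemma chartForm_multiDeriv_isBigO (hφ : φ ∈ atlas (EuclSp n) M) (hw : IsWeight φ.target w)
    {a b : ℕ} {α β : List (Fin n)} (hα : α.length ≤ a) (hβ : β.length ≤ b) :
    chartForm φ w (multiDeriv α) (multiDeriv β) =O[⊤] sobolevProd g a b := by
  have hU := φ.open_target
  have hK : IsCompact (tsupport w) := hw.compact
  obtain ⟨C₁, hC₁, h₁⟩ := exists_setIntegral_sq_multiDeriv_le g hφ hK hw.subset a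
  obtain ⟨C₂, hC₂, h₂⟩ := exists_setIntegral_sq_multiDeriv_le g hφ hK hw.subset b
  obtain ⟨C, hC⟩ := hK.exists_bound_of_continuousOn hw.contDiff.continuous.continuousOn
  refine IsBigO.of_bound (|C| * √C₁ * √C₂) (.of_forall fun X => ?_)
  have hu := (contDiffOn_multiDeriv hU (contDiffOn_comp_symm hφ X.1) α).continuousOn.mono hw.subset
  have hv := (contDiffOn_multiDeriv hU (contDiffOn_comp_symm hφ X.2) β).continuousOn.mono hw.subset
  have e : chartForm φ w (multiDeriv α) (multiDeriv β) X = ∫ y in tsupport w,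
      (w y * multiDeriv α (X.1 ∘ φ.symm) y) * multiDeriv β (X.2 ∘ φ.symm) y := by
    refine (MeasureTheory.setIntegral_eq_integral_of_forall_compl_eq_zero fun y hy => ?_).symm
    rw [image_eq_zero_of_notMem_tsupport hy, zero_mul, zero_mul]
  have h3 := abs_setIntegral_mul_le hK (hw.contDiff.continuous.continuousOn.mul hu) hv
  have h4 : √(∫ y in tsupport w, (w y * multiDeriv α (X.1 ∘ φ.symm) y) ^ 2) ≤
      |C| * √C₁ * sobolevNorm g a X.1 := by
    refine Real.sqrt_le_iff.2 ⟨mul_nonneg (by positivity) (sobolevNorm_nonneg g _ _), ?_⟩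
    rw [mul_pow, mul_pow, sq_abs, Real.sq_sqrt hC₁, mul_assoc]
    refine le_trans ?_ (mul_le_mul_of_nonneg_left (h₁ X.1 α hα) (sq_nonneg C))
    rw [← MeasureTheory.integral_const_mul]
    refine MeasureTheory.setIntegral_mono_on
      (((hw.contDiff.continuous.continuousOn.mul hu).pow 2).integrableOn_compact hK)
      (((hu.pow 2).integrableOn_compact hK).const_mul _) hK.measurableSet fun y hy => ?_
    rw [mul_pow]
    refine mul_le_mul_of_nonneg_right ?_ (sq_nonneg _)
    exact sq_le_sq.2 ((hC y hy).trans (le_abs_self _))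
  have h5 : √(∫ y in tsupport w, multiDeriv β (X.2 ∘ φ.symm) y ^ 2) ≤
      √C₂ * sobolevNorm g b X.2 := by
    refine Real.sqrt_le_iff.2 ⟨mul_nonneg (by positivity) (sobolevNorm_nonneg g _ _), ?_⟩
    rw [mul_pow, Real.sq_sqrt hC₂]
    exact h₂ X.2 β hβ
  rw [e, Real.norm_eq_abs]
  refine h3.trans ((mul_le_mul h4 h5 (Real.sqrt_nonneg _) (mul_nonneg (by positivity)
    (sobolevNorm_nonneg g _ _))).trans ?_)
  rw [Real.norm_eq_abs]
  refine le_trans (le_of_eq ?_) (mul_le_mul_of_nonneg_left (le_abs_self _) (by positivity))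
  unfold sobolevProd
  ring

/-- Only the total number of derivatives matters: they can be distributed among the two factors by
integration by parts. -/
lemma chartForm_multiDeriv_isBigO_of_add (hφ : φ ∈ atlas (EuclSp n) M)
    (hw : IsWeight φ.target w) {a b : ℕ} {α β : List (Fin n)}
    (h : α.length + β.length ≤ a + b) :
    chartForm φ w (multiDeriv α) (multiDeriv β) =O[⊤] sobolevProd g a b := by
  have left : ∀ (α β : List (Fin n)) (w : EuclSp n → ℝ), IsWeight φ.target w →
      α.length + β.length ≤ a + b → β.length ≤ b →
      chartForm φ w (multiDeriv α) (multiDeriv β) =O[⊤] sobolevProd g a b := by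
    intro α
    induction α with
    | nil => exact fun β w hw _ hβ => chartForm_multiDeriv_isBigO g hφ hw (Nat.zero_le _) hβ
    | cons i α ih =>
        intro β w hw h hβ
        by_cases hα : (i :: α).length ≤ a
        · exact chartForm_multiDeriv_isBigO g hφ hw hα hβ
        · simp only [List.length_cons] at h hα
          refine ((ih (i :: β) w hw (by simp; omega) (by simp; omega)).neg_left.sub
            (ih β _ (hw.pderiv i) (by omega) hβ)).congr_left fun X => ?_
          exact (chartForm_cons_left hφ hw i α β X).symm
  have right : ∀ (β α : List (Fin n)) (w : EuclSp n → ℝ), IsWeight φ.target w →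
      α.length + β.length ≤ a + b → α.length ≤ a →
      chartForm φ w (multiDeriv α) (multiDeriv β) =O[⊤] sobolevProd g a b := by
    intro β
    induction β with
    | nil => exact fun α w hw _ hα => chartForm_multiDeriv_isBigO g hφ hw hα (Nat.zero_le _)
    | cons i β ih =>
        intro α w hw h hα
        by_cases hβ : (i :: β).length ≤ b
        · exact chartForm_multiDeriv_isBigO g hφ hw hα hβ
        · simp only [List.length_cons] at h hβ
          refine ((ih (i :: α) w hw (by simp; omega) (by simp; omega)).neg_left.sub
            (ih α _ (hw.pderiv i) (by omega) hα)).congr_left fun X => ?_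
          rw [chartForm_cons_left hφ hw i α β X]
          ring
  by_cases hβ : β.length ≤ b
  · exact left α β w hw h hβ
  · exact right β α w hw h (by omega)

/-- A product of operators of orders at most `m - 1` and `m' - 1` has at most `m + m' - 2`
derivatives in all, whence the condition on `a + b`. -/
lemma chartForm_lowerOrder_isBigO (hφ : φ ∈ atlas (EuclSp n) M) (hw : IsWeight φ.target w)
    {a b m m' : ℕ} (h : m + m' ≤ a + b + 2) {A B : (EuclSp n → ℝ) → EuclSp n → ℝ}
    (hA : LowerOrder φ.target m A) (hB : LowerOrder φ.target m' B) :
    chartForm φ w A B =O[⊤] sobolevProd g a b := by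
  have hU := φ.open_target
  induction hA with
  | zero => exact (isBigO_zero _ _).congr_left fun X => by simp [chartForm]
  | @monomial p α hp hα =>
      induction hB with
      | zero => exact (isBigO_zero _ _).congr_left fun X => by simp [chartForm]
      | @monomial q β hq hβ =>
          refine (chartForm_multiDeriv_isBigO_of_add g hφ ((hw.mul hU hp).mul hU hq) (a := a)
            (b := b) (α := α) (β := β) (by omega)).congr_left fun X => ?_
          unfold chartForm
          congr 1
          ext y
          ring
      | add h₁ h₂ ih₁ ih₂ =>
          exact (ih₁.add ih₂).congr_left fun X =>
            (chartForm_add_right hφ hw (LowerOrder.monomial p α hp hα) h₁ h₂ X).symm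
      | congr h₁ he ih =>
          refine ih.congr_left fun X => chartForm_congr hw hw fun y hy => ?_
          rw [he _ (contDiffOn_comp_symm hφ X.2) y hy]
  | add h₁ h₂ ih₁ ih₂ =>
      exact (ih₁.add ih₂).congr_left fun X => (chartForm_add_left hφ hw h₁ h₂ hB X).symm
  | congr h₁ he ih =>
      refine ih.congr_left fun X => chartForm_congr hw hw fun y hy => ?_
      rw [he _ (contDiffOn_comp_symm hφ X.1) y hy]

/-- Moving a block `∂^α` of derivatives from one factor to the other changes the sign by
`(-1)^{|α|}`, up to terms with one derivative less. -/
lemma chartForm_move_isBigO (hφ : φ ∈ atlas (EuclSp n) M) (hw : IsWeight φ.target w) {a b : ℕ}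
    {α β : List (Fin n)} (h : α.length + β.length ≤ a + b + 1) :
    (fun X => chartForm φ w (multiDeriv []) (multiDeriv (α ++ β)) X -
      (-1) ^ α.length * chartForm φ w (multiDeriv α) (multiDeriv β) X) =O[⊤]
        sobolevProd g a b := by
  have key : ∀ α γ : List (Fin n), γ.length + α.length + β.length ≤ a + b + 1 →
      (fun X => chartForm φ w (multiDeriv γ) (multiDeriv (α ++ β)) X -
        (-1) ^ α.length * chartForm φ w (multiDeriv (α.reverse ++ γ)) (multiDeriv β) X) =O[⊤]
          sobolevProd g a b := by
    intro α
    induction α with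
    | nil => exact fun γ _ => (isBigO_zero _ _).congr_left fun X => by simp
    | cons i α ih =>
        intro γ h
        simp only [List.length_cons] at h
        refine ((ih (i :: γ) (by simp; omega)).neg_left.sub
          (chartForm_multiDeriv_isBigO_of_add g hφ (hw.pderiv i) (a := a) (b := b) (α := γ)
            (β := α ++ β) (by simp; omega))).congr_left fun X => ?_
        have h1 := chartForm_cons_left hφ hw i γ (α ++ β) X
        simp only [List.cons_append, List.reverse_cons, List.append_assoc, List.nil_append,
          List.length_cons, pow_succ]
        linear_combination -h1
  refine (key α [] (by simpa using h)).congr_left fun X => ?_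
  congr 2
  refine chartForm_congr hw hw fun y hy => ?_
  rw [multiDeriv_perm φ.open_target (contDiffOn_comp_symm hφ X.1)
    (show (α.reverse ++ []).Perm α by simp) y hy]

end ChartForms

/-! ### The energy and the Gårding inequality -/

section Energy

open Asymptotics

variable {n : ℕ} {M : Type*} [TopologicalSpace M] [ChartedSpace (EuclSp n) M]
  [IsManifold (𝓡 n) ∞ M] (g : RiemMetric n M) {k : ℕ}
  {P : SmoothFun n M →ₗ[ℝ] SmoothFun n M}

/-- The coefficient `g^{i_1 j_1} ⋯ g^{i_l j_l}`. -/
def gramInvProd (φ : OpenPartialHomeomorph M (EuclSp n)) {l : ℕ}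
    (X : (Fin l → Fin n) × (Fin l → Fin n)) (y : EuclSp n) : ℝ :=
  ∏ s, gramInv g φ y (X.1 s) (X.2 s)

lemma contDiffOn_gramInvProd {φ : OpenPartialHomeomorph M (EuclSp n)} (hφ : φ ∈ atlas (EuclSp n) M)
    {l : ℕ} (X : (Fin l → Fin n) × (Fin l → Fin n)) :
    ContDiffOn ℝ ∞ (gramInvProd g φ X) φ.target :=
  contDiffOn_prod fun _ _ => contDiffOn_gramInv g hφ _ _

/-- The expression of `P` in a chart. -/
lemma exists_lowerOrder_of_hasLeadingPart (hP : HasLeadingPart g k P)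
    {φ : OpenPartialHomeomorph M (EuclSp n)} (hφ : φ ∈ atlas (EuclSp n) M) :
    ∃ R, LowerOrder φ.target (2 * k) R ∧ ∀ u : SmoothFun n M, ∀ y ∈ φ.target,
      P u (φ.symm y) = ∑ X : (Fin k → Fin n) × (Fin k → Fin n), (-1) ^ k * gramInvProd g φ X y *
        multiDeriv (List.ofFn X.1 ++ List.ofFn X.2) (u ∘ φ.symm) y + R (u ∘ φ.symm) y := by
  obtain ⟨a, ha, haP⟩ := hP φ hφ
  have h1 := lowerOrder_iterate_localLaplacian_sub g hφ k
  have h2 : LowerOrder φ.target (2 * k) fun f y => ∑ l ∈ Finset.range (2 * k),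
      ∑ I : Fin l → Fin n, a l I y * multiDeriv (List.ofFn I) f y :=
    LowerOrder.sum _ fun l hl => LowerOrder.sum _ fun I _ =>
      LowerOrder.monomial _ _ (ha l I) (by simpa using hl)
  refine ⟨_, h1.add h2, fun u y hy => ?_⟩
  have h3 := haP u y hy
  simp only at h3
  rw [iterate_laplaceBeltrami_symm g hφ u.contMDiff k y hy] at h3
  have h4 : ∀ (l : ℕ) (I : Fin l → Fin n), multiDeriv (List.ofFn I) (u ∘ φ.symm) y =
      iteratedFDeriv ℝ l (u ∘ φ.symm) y fun s => EuclideanSpace.single (I s) 1 := fun l I =>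
    multiDeriv_ofFn φ.open_target (contDiffOn_comp_symm hφ u) l I y hy
  simp only [h4, ← h3, gramInvProd]
  ring

lemma lowerOrder_covDeriv {φ : OpenPartialHomeomorph M (EuclSp n)} (hφ : φ ∈ atlas (EuclSp n) M)
    {l : ℕ} (I : Fin l → Fin n) : LowerOrder φ.target (l + 1) fun f => covDeriv g φ f l I :=
  (((lowerOrder_covDeriv_sub g hφ l I).mono (Nat.le_succ l)).add (LowerOrder.multiDeriv
    (α := List.ofFn I) (by simp))).congr fun f _ y _ => by ring

variable [T2Space M] [CompactSpace M]

/-- The weight `ρ_p √(det g)` of `chartIntegral` in the chart at `p`, extended by zero. -/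
def chartWeight (p : M) : EuclSp n → ℝ :=
  (chartAt (EuclSp n) p).target.indicator fun y =>
    chartPartition n M p ((chartAt (EuclSp n) p).symm y) * volDensity g (chartAt (EuclSp n) p) y

lemma isWeight_chartWeight (p : M) :
    IsWeight (chartAt (EuclSp n) p).target (chartWeight g p) := by
  set φ := chartAt (EuclSp n) p
  have hφ : φ ∈ atlas (EuclSp n) M := chart_mem_atlas _ p
  have hsub := tsupport_chartPartition (n := n) p
  have hKc : IsCompact (φ '' tsupport (chartPartition n M p)) :=
    ((isClosed_tsupport _).isCompact).image_of_continuousOn (φ.continuousOn.mono hsub)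
  have hKt : φ '' tsupport (chartPartition n M p) ⊆ φ.target := by
    rintro _ ⟨q, hq, rfl⟩
    exact φ.map_source (hsub hq)
  have hts : tsupport (chartWeight g p) ⊆ φ '' tsupport (chartPartition n M p) := by
    refine closure_minimal (fun y hy => ?_) hKc.isClosed
    have hy' : y ∈ φ.target := Set.mem_of_indicator_ne_zero hy
    rw [Function.mem_support, chartWeight, Set.indicator_of_mem hy'] at hy
    exact ⟨φ.symm y, subset_tsupport _ (left_ne_zero_of_mul hy), φ.right_inv hy'⟩
  refine ⟨contDiff_of_contDiffOn_of_tsupport_subset φ.open_target ?_ (hts.trans hKt),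
    hKc.of_isClosed_subset (isClosed_tsupport _) hts, hts.trans hKt⟩
  have h1 : ContDiffOn ℝ ∞ (chartPartition n M p ∘ φ.symm) φ.target :=
    contDiffOn_comp_symm hφ (chartPartition n M p)
  exact (h1.mul (contDiffOn_volDensity g hφ)).congr fun y hy => Set.indicator_of_mem hy _

lemma chartIntegral_eq (F : M → EuclSp n → ℝ) :
    chartIntegral g F = ∑ p ∈ chartCenters n M, ∫ y, chartWeight g p y * F p y := by
  refine Finset.sum_congr rfl fun p _ => ?_
  rw [← MeasureTheory.integral_indicator (chartAt (EuclSp n) p).open_target.measurableSet]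
  congr 1
  ext y
  by_cases hy : y ∈ (chartAt (EuclSp n) p).target
  · simp [chartWeight, hy]
  · simp [chartWeight, hy]

lemma covL2Inner_eq (l : ℕ) (u v : SmoothFun n M) : covL2Inner g l u v =
    ∑ p ∈ chartCenters n M, ∑ X : (Fin l → Fin n) × (Fin l → Fin n),
      chartForm (chartAt (EuclSp n) p)
        (fun y => chartWeight g p y * gramInvProd g (chartAt (EuclSp n) p) X y)
        (fun f => covDeriv g (chartAt (EuclSp n) p) f l X.1)
        (fun f => covDeriv g (chartAt (EuclSp n) p) f l X.2) (u, v) := by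
  rw [covL2Inner, chartIntegral_eq]
  refine Finset.sum_congr rfl fun p _ => ?_
  set φ := chartAt (EuclSp n) p
  have hφ : φ ∈ atlas (EuclSp n) M := chart_mem_atlas _ p
  have hU := φ.open_target
  unfold chartForm
  rw [← MeasureTheory.integral_finsetSum _ fun X _ =>
    ((((isWeight_chartWeight g p).mul hU (contDiffOn_gramInvProd g hφ X)).mul hU
      ((lowerOrder_covDeriv g hφ X.1).contDiffOn_comp_symm hφ u)).mul hU
      ((lowerOrder_covDeriv g hφ X.2).contDiffOn_comp_symm hφ v)).integrable]
  congr 1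
  ext y
  simp only [covInner, ← Fintype.sum_prod_type', Finset.mul_sum, gramInvProd]
  exact Finset.sum_congr rfl fun X _ => by ring

lemma covL2Inner_isBigO {l a b : ℕ} (h : 2 * l ≤ a + b) :
    (fun X : SmoothFun n M × SmoothFun n M => covL2Inner g l X.1 X.2) =O[⊤] sobolevProd g a b := by
  simp only [covL2Inner_eq]
  refine IsBigO.fun_sum fun p _ => IsBigO.fun_sum fun X _ => ?_
  have hφ := chart_mem_atlas (EuclSp n) p
  exact chartForm_lowerOrder_isBigO g hφ ((isWeight_chartWeight g p).mul
    (chartAt (EuclSp n) p).open_target (contDiffOn_gramInvProd g hφ X)) (by omega)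
    (lowerOrder_covDeriv g hφ X.1) (lowerOrder_covDeriv g hφ X.2)

lemma energy_eq {R : M → (EuclSp n → ℝ) → EuclSp n → ℝ}
    (hR : ∀ p, LowerOrder (chartAt (EuclSp n) p).target (2 * k) (R p))
    (hRP : ∀ p, ∀ u : SmoothFun n M, ∀ y ∈ (chartAt (EuclSp n) p).target,
      P u ((chartAt (EuclSp n) p).symm y) = ∑ X : (Fin k → Fin n) × (Fin k → Fin n),
        (-1) ^ k * gramInvProd g (chartAt (EuclSp n) p) X y *
          multiDeriv (List.ofFn X.1 ++ List.ofFn X.2) (u ∘ (chartAt (EuclSp n) p).symm) y +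
        R p (u ∘ (chartAt (EuclSp n) p).symm) y) (u v : SmoothFun n M) :
    riemIntegral g (fun p => u p * P v p) = ∑ p ∈ chartCenters n M,
      (∑ X : (Fin k → Fin n) × (Fin k → Fin n), (-1) ^ k * chartForm (chartAt (EuclSp n) p)
        (fun y => chartWeight g p y * gramInvProd g (chartAt (EuclSp n) p) X y)
        (multiDeriv []) (multiDeriv (List.ofFn X.1 ++ List.ofFn X.2)) (u, v) +
      chartForm (chartAt (EuclSp n) p) (chartWeight g p) (multiDeriv []) (R p) (u, v)) := by
  rw [riemIntegral, chartIntegral_eq]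
  refine Finset.sum_congr rfl fun p _ => ?_
  have hRp := hR p
  have hRPp := hRP p
  set φ := chartAt (EuclSp n) p
  have hφ : φ ∈ atlas (EuclSp n) M := chart_mem_atlas _ p
  have hU := φ.open_target
  have hw := isWeight_chartWeight g p
  have hu := contDiffOn_comp_symm hφ u
  unfold chartForm
  have hi := fun X : (Fin k → Fin n) × (Fin k → Fin n) =>
    (((hw.mul hU (contDiffOn_gramInvProd g hφ X)).mul hU hu).mul hU
      (contDiffOn_multiDeriv hU (contDiffOn_comp_symm hφ v)
        (List.ofFn X.1 ++ List.ofFn X.2))).integrable.const_mul ((-1) ^ k)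
  simp only [← MeasureTheory.integral_const_mul]
  have hs := MeasureTheory.integral_finsetSum Finset.univ fun X _ => hi X
  refine Eq.trans ?_ (congrArg₂ (· + ·) hs rfl)
  have hadd := MeasureTheory.integral_add
    (MeasureTheory.integrable_finsetSum Finset.univ fun X _ => hi X)
    ((hw.mul hU hu).mul hU (hRp.contDiffOn_comp_symm hφ v)).integrable
  refine Eq.trans ?_ hadd
  refine MeasureTheory.integral_congr_ae (.of_forall fun y => ?_)
  by_cases hy : y ∈ φ.target
  · simp only [hRPp v y hy, mul_add, Finset.mul_sum]
    congr 1
    · exact Finset.sum_congr rfl fun X _ => by simp only [Function.comp_apply]; ring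
    · simp only [Function.comp_apply]; ring
  · have h1 : chartWeight g p y = 0 := image_eq_zero_of_notMem_tsupport fun h => hy (hw.subset h)
    simp [h1]

/-- The energy differs from `∫ (∇^k u, ∇^k v)_g dv_g` by terms with at most `2k - 1` derivatives.
The reason is that partial derivatives commute: after the `k` derivatives `∂_I` of the leading term
`(-1)^k ∏ g^{i_s j_s} ∂_I ∂_J` have been moved to the other factor, one gets the full contraction
of `∂^k u` with `∂^k v`. -/
lemma energy_sub_covL2Inner_isBigO (hP : HasLeadingPart g k P) {a b : ℕ} (h : 2 * k ≤ a + b + 1) :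
    (fun X : SmoothFun n M × SmoothFun n M => riemIntegral g (fun p => X.1 p * P X.2 p) -
      covL2Inner g k X.1 X.2) =O[⊤] sobolevProd g a b := by
  choose R hR hRP using fun p : M =>
    exists_lowerOrder_of_hasLeadingPart g hP (chart_mem_atlas (EuclSp n) p)
  simp only [energy_eq g hR hRP, covL2Inner_eq, ← Finset.sum_sub_distrib, add_sub_right_comm]
  refine IsBigO.fun_sum fun p _ => ?_
  have hRp := hR p
  set φ := chartAt (EuclSp n) p
  have hφ : φ ∈ atlas (EuclSp n) M := chart_mem_atlas _ p
  have hw := isWeight_chartWeight g p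
  refine IsBigO.add (IsBigO.fun_sum fun X _ => ?_) (chartForm_lowerOrder_isBigO g hφ hw (m := 1)
    (by omega) (LowerOrder.multiDeriv (by simp)) hRp)
  obtain ⟨I, J⟩ := X
  have hw' := hw.mul φ.open_target (contDiffOn_gramInvProd g hφ (I, J))
  set w' := fun y => chartWeight g p y * gramInvProd g φ (I, J) y
  have hI := lowerOrder_covDeriv_sub g hφ k I
  have hJ := lowerOrder_covDeriv_sub g hφ k J
  have hD : ∀ I : Fin k → Fin n, LowerOrder φ.target (k + 1) (multiDeriv (List.ofFn I)) :=
    fun I => LowerOrder.multiDeriv (by simp)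
  have h1 := (chartForm_move_isBigO g hφ hw' (a := a) (b := b) (α := List.ofFn I)
    (β := List.ofFn J) (by simp; omega)).const_mul_left ((-1) ^ k)
  have h2 := chartForm_lowerOrder_isBigO g hφ hw' (a := a) (b := b) (by omega) hI
    (lowerOrder_covDeriv g hφ J)
  have h3 := chartForm_lowerOrder_isBigO g hφ hw' (a := a) (b := b) (by omega) (hD I) hJ
  refine ((h1.sub h2).sub h3).congr_left fun X => ?_
  have e1 : chartForm φ w' (fun f => covDeriv g φ f k I) (fun f => covDeriv g φ f k J) X =
      chartForm φ w' (fun f y => covDeriv g φ f k I y - multiDeriv (List.ofFn I) f y)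
        (fun f => covDeriv g φ f k J) X +
      chartForm φ w' (multiDeriv (List.ofFn I)) (fun f => covDeriv g φ f k J) X := by
    rw [← chartForm_add_left hφ hw' (hI.mono (Nat.le_succ k)) (hD I) (lowerOrder_covDeriv g hφ J)]
    simp only [sub_add_cancel]
  have e2 : chartForm φ w' (multiDeriv (List.ofFn I)) (fun f => covDeriv g φ f k J) X =
      chartForm φ w' (multiDeriv (List.ofFn I))
        (fun f y => covDeriv g φ f k J y - multiDeriv (List.ofFn J) f y) X +
      chartForm φ w' (multiDeriv (List.ofFn I)) (multiDeriv (List.ofFn J)) X := by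
    rw [← chartForm_add_right hφ hw' (hD I) (hJ.mono (Nat.le_succ k)) (hD J)]
    simp only [sub_add_cancel]
  have e3 : ((-1 : ℝ) ^ k) * (-1) ^ k = 1 := by rw [← mul_pow]; simp
  simp only [List.length_ofFn]
  rw [e1, e2]
  linear_combination -chartForm φ w' (multiDeriv (List.ofFn I)) (multiDeriv (List.ofFn J)) X * e3

/-- The energy is continuous for the norm of `H_k^2`. -/
lemma energy_isBigO (hP : HasLeadingPart g k P) :
    (fun X : SmoothFun n M × SmoothFun n M => riemIntegral g fun p => X.1 p * P X.2 p) =O[⊤]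
      sobolevProd g k k :=
  ((energy_sub_covL2Inner_isBigO g hP (by omega)).add
    (covL2Inner_isBigO g (l := k) (by omega))).congr_left fun X => by ring

/-- Interpolation: `‖u‖_{H_{l+1}}² ≤ C ‖u‖_{H_{l+2}} ‖u‖_{H_l}`. -/
lemma exists_sq_sobolevNorm_le (l : ℕ) : ∃ C, 0 ≤ C ∧ ∀ u : SmoothFun n M,
    sobolevNorm g (l + 1) u ^ 2 ≤ C * (sobolevNorm g (l + 2) u * sobolevNorm g l u) := by
  obtain ⟨C, hC⟩ := isBigO_top.1
    (covL2Inner_isBigO (n := n) (M := M) g (l := l + 1) (a := l + 2) (b := l) (by omega))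
  refine ⟨2 * |C| + 2, by positivity, fun u => ?_⟩
  have h1 := hC (u, u)
  have hN := sobolevNorm_nonneg g l u
  have hN2 := sobolevNorm_nonneg g (l + 2) u
  have hp := mul_nonneg hN2 hN
  rw [Real.norm_eq_abs, Real.norm_eq_abs, sobolevProd, abs_of_nonneg hp,
    abs_of_nonneg (covL2Inner_self_nonneg g _ u), ← sq_covL2Norm] at h1
  have h2 : sobolevNorm g (l + 1) u = sobolevNorm g l u + covL2Norm g (l + 1) u :=
    Finset.sum_range_succ _ _
  have h3 := mul_le_mul_of_nonneg_right (sobolevNorm_mono g (Nat.le_add_right l 2) u) hN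
  have h4 := mul_le_mul_of_nonneg_right (le_abs_self C) hp
  rw [h2]
  nlinarith [sq_nonneg (sobolevNorm g l u - covL2Norm g (l + 1) u)]

/-- Ehrling's inequality. -/
lemma exists_sobolevNorm_le (l : ℕ) : ∀ ε > 0, ∃ C, 0 ≤ C ∧ ∀ u : SmoothFun n M,
    sobolevNorm g l u ≤ ε * sobolevNorm g (l + 1) u + C * l2Norm g u := by
  induction l with
  | zero =>
      intro ε hε
      refine ⟨1, zero_le_one, fun u => ?_⟩
      have h1 : sobolevNorm g 0 u = l2Norm g u := by simp [sobolevNorm, l2Norm_eq]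
      have := mul_nonneg hε.le (sobolevNorm_nonneg g (0 + 1) u)
      linarith
  | succ l ih =>
      intro ε hε
      obtain ⟨A, hA, hA'⟩ := exists_sq_sobolevNorm_le (n := n) (M := M) g l
      -- The interpolation inequality gives `N_{l+1} ≤ (ε/2) N_{l+2} + (A/(2ε)) N_l`; with the
      -- constant `ε/(A+1)` in the induction hypothesis the last term is at most
      -- `N_{l+1}/2 + (AC/(2ε)) ‖u‖_2`.
      obtain ⟨C, hC, hC'⟩ := ih (ε / (A + 1)) (by positivity)
      refine ⟨A * C / ε, by positivity, fun u => ?_⟩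
      have h0 := sobolevNorm_nonneg g l u
      have h1 := sobolevNorm_nonneg g (l + 1) u
      have h2 := sobolevNorm_nonneg g (l + 2) u
      have hL : 0 ≤ l2Norm g u := Real.sqrt_nonneg _
      have h3 := hA' u
      have h4 := hC' u
      set N0 := sobolevNorm g l u
      set N1 := sobolevNorm g (l + 1) u
      set N2 := sobolevNorm g (l + 2) u
      set L := l2Norm g u
      have h5 : N1 ≤ ε / 2 * N2 + A / (2 * ε) * N0 := by
        refine abs_le_of_sq_le_sq' ?_ (by positivity) |>.2
        have e : (ε / 2 * N2 + A / (2 * ε) * N0) ^ 2 =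
          A * (N2 * N0) + (ε / 2 * N2 - A / (2 * ε) * N0) ^ 2 := by
          field_simp; ring
        nlinarith [sq_nonneg (ε / 2 * N2 - A / (2 * ε) * N0)]
      have h6 : A / (2 * ε) * N0 ≤ A / (2 * ε) * (ε / (A + 1) * N1 + C * L) :=
        mul_le_mul_of_nonneg_left h4 (by positivity)
      have h7 : A / (2 * ε) * (ε / (A + 1) * N1 + C * L) =
          1 / 2 * N1 - 1 / (2 * (A + 1)) * N1 + A * C / ε / 2 * L := by
        field_simp; ring
      have h8 : 0 ≤ 1 / (2 * (A + 1)) * N1 := by positivity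
      linarith

/-- The Gårding inequality. -/
lemma exists_garding (hk : 1 ≤ k) (hP : HasLeadingPart g k P) :
    ∃ c > 0, ∃ C, 0 ≤ C ∧ ∀ u : SmoothFun n M,
      c * sobolevNorm g k u ^ 2 ≤ riemIntegral g (fun p => u p * P u p) + C * l2Norm g u ^ 2 := by
  obtain ⟨m, rfl⟩ : ∃ m, k = m + 1 := ⟨k - 1, by omega⟩
  obtain ⟨A, hA⟩ := isBigO_top.1
    (energy_sub_covL2Inner_isBigO g hP (a := m + 1) (b := m) (by omega))
  obtain ⟨C, hC0, hC⟩ := exists_sobolevNorm_le (n := n) (M := M) g m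
    (1 / (4 * (|A| + 2))) (by positivity)
  refine ⟨1 / 8, by norm_num, 2 * (|A| + 2) ^ 2 * C ^ 2, by positivity, fun u => ?_⟩
  have h1 := hA (u, u)
  have h2 := hC u
  have h3 : sobolevNorm g (m + 1) u = sobolevNorm g m u + covL2Norm g (m + 1) u :=
    Finset.sum_range_succ _ _
  have h0 := sobolevNorm_nonneg g m u
  have h0' := sobolevNorm_nonneg g (m + 1) u
  have hL : 0 ≤ l2Norm g u := Real.sqrt_nonneg _
  have hT : 0 ≤ covL2Norm g (m + 1) u := Real.sqrt_nonneg _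
  rw [Real.norm_eq_abs, Real.norm_eq_abs, sobolevProd, abs_of_nonneg (mul_nonneg h0' h0),
    ← sq_covL2Norm] at h1
  simp only at h1
  have h4 := mul_le_mul_of_nonneg_right (le_abs_self A) (mul_nonneg h0' h0)
  have h5 := (abs_le.1 (h1.trans h4)).1
  set N := sobolevNorm g (m + 1) u
  set N' := sobolevNorm g m u
  set T := covL2Norm g (m + 1) u
  set L := l2Norm g u
  set Q := riemIntegral g fun p => u p * P u p
  set B := |A| + 2 with hB
  have hB0 : 0 < B := by positivity
  -- `T = N - N'`, so `Q ≥ (N - N')² - |A| N N' ≥ N² - B N N'`.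
  have h6 : N ^ 2 - B * (N * N') ≤ Q := by
    have : T = N - N' := by linarith
    rw [this] at h5
    nlinarith [sq_nonneg N']
  have h7 : B * (N * N') ≤ 1 / 4 * N ^ 2 + B * C * (N * L) := by
    have := mul_le_mul_of_nonneg_left h2 (mul_nonneg hB0.le h0')
    calc B * (N * N') = B * N * N' := by ring
      _ ≤ B * N * (1 / (4 * B) * N + C * L) := this
      _ = _ := by field_simp
  nlinarith [sq_nonneg (N / 2 - B * C * L), sq_nonneg (B * C * L)]

end Energy

/-! ### Extension to the completion and equivalence of norms -/

section Completion

open UniformSpace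

/-- A continuous bilinear form on a seminormed space extends to the completion. -/
lemma exists_extension_bilinear {E : Type*} [SeminormedAddCommGroup E] [NormedSpace ℝ E]
    (f : E →L[ℝ] E →L[ℝ] ℝ) : ∃ B : Completion E →L[ℝ] Completion E →L[ℝ] ℝ,
      ∀ u v : E, B u v = f u v := by
  have hd : DenseRange (Completion.toComplL : E →L[ℝ] Completion E) :=
    Completion.denseRange_coe
  have hi : IsUniformInducing (Completion.toComplL : E →L[ℝ] Completion E) :=
    Completion.isUniformInducing_coe E
  set F₁ : Completion E →L[ℝ] E →L[ℝ] ℝ := f.extend Completion.toComplL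
  have h₁ : ∀ u : E, F₁ u = f u := fun u => ContinuousLinearMap.extend_eq f hd hi u
  set F₂ : Completion E →L[ℝ] Completion E →L[ℝ] ℝ := F₁.flip.extend Completion.toComplL
  have h₂ : ∀ v : E, F₂ v = F₁.flip v := fun v => ContinuousLinearMap.extend_eq F₁.flip hd hi v
  refine ⟨F₂.flip, fun u v => ?_⟩
  rw [ContinuousLinearMap.flip_apply, h₂, ContinuousLinearMap.flip_apply, h₁]

end Completion

section Norms

variable {V : Type*} [AddCommGroup V] [Module ℝ V]

/-- A symmetric positive definite bilinear form defines a norm. -/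
lemma isNorm_sqrt (B : V →ₗ[ℝ] V →ₗ[ℝ] ℝ) (hs : ∀ u v, B u v = B v u) (h0 : ∀ u, 0 ≤ B u u)
    (hd : ∀ u, B u u = 0 → u = 0) : IsNorm fun u => √(B u u) := by
  let c : PreInnerProductSpace.Core ℝ V :=
    { inner := fun u v => B u v
      conj_inner_symm := fun u v => hs v u
      re_inner_nonneg := h0
      add_left := fun u v w => by simp
      smul_left := fun u v r => by simp }
  let := @InnerProductSpace.Core.toNorm ℝ _ _ _ _ c
  have hc := InnerProductSpace.Core.toSeminormedSpaceCore c
  exact ⟨fun u => Real.sqrt_nonneg _, fun u => by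
    rw [Real.sqrt_eq_zero (h0 u)]; exact ⟨hd u, fun h => by simp [h]⟩,
    hc.norm_smul, hc.norm_triangle⟩

end Norms

section Sobolev

variable {n : ℕ} {M : Type*} [TopologicalSpace M] [ChartedSpace (EuclSp n) M]
  [IsManifold (𝓡 n) ∞ M] [T2Space M] [CompactSpace M] {g : RiemMetric n M} {k : ℕ}
  {P : SmoothFun n M →ₗ[ℝ] SmoothFun n M}

lemma riemIntegral_mul (u v : SmoothFun n M) :
    riemIntegral g (fun p => u p * v p) = covL2Inner g 0 u v := by
  have h : ∀ (φ : OpenPartialHomeomorph M (EuclSp n)) (f h : EuclSp n → ℝ) (y : EuclSp n),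
      covInner g φ 0 f h y = f y * h y := fun φ f h y => by simp [covInner, covDeriv]
  simp only [riemIntegral, covL2Inner, chartIntegral, h]
  rfl

lemma covL2Inner_comm (l : ℕ) (u v : SmoothFun n M) : covL2Inner g l u v = covL2Inner g l v u :=
  (covL2Core g l).conj_inner_symm v u

lemma covL2Inner_add_left (l : ℕ) (u v w : SmoothFun n M) :
    covL2Inner g l (u + v) w = covL2Inner g l u w + covL2Inner g l v w :=
  (covL2Core g l).add_left u v w

lemma covL2Inner_smul_left (l : ℕ) (c : ℝ) (u v : SmoothFun n M) :
    covL2Inner g l (c • u) v = c * covL2Inner g l u v :=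
  (covL2Core g l).smul_left u v c

lemma dense_toSobolev : DenseRange (toSobolev : SmoothFun n M → Sobolev g k) :=
  UniformSpace.Completion.denseRange_coe (α := PreSobolev g k)

lemma continuous_sobolevL2Norm : Continuous (sobolevL2Norm : Sobolev g k → ℝ) :=
  UniformSpace.Completion.continuous_extension

lemma covL2Inner_add_right (l : ℕ) (u v w : SmoothFun n M) :
    covL2Inner g l u (v + w) = covL2Inner g l u v + covL2Inner g l u w := by
  rw [covL2Inner_comm, covL2Inner_add_left, covL2Inner_comm, covL2Inner_comm l w]

lemma covL2Inner_smul_right (l : ℕ) (c : ℝ) (u v : SmoothFun n M) :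
    covL2Inner g l u (c • v) = c * covL2Inner g l u v := by
  rw [covL2Inner_comm, covL2Inner_smul_left, covL2Inner_comm]

variable (g k P) in
/-- The bilinear form `(u, v) ↦ ∫_M u P v dv_g` on `C^∞(M)`. -/
def energyForm : PreSobolev g k →ₗ[ℝ] PreSobolev g k →ₗ[ℝ] ℝ :=
  LinearMap.mk₂ ℝ (fun u v : SmoothFun n M => covL2Inner g 0 u (P v))
    (fun u u' v => covL2Inner_add_left 0 u u' (P v))
    (fun c u v => covL2Inner_smul_left 0 c u (P v))
    (fun u v v' => (congrArg (covL2Inner g 0 u) (P.map_add v v')).trans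
      (covL2Inner_add_right 0 u (P v) (P v')))
    (fun c u v => (congrArg (covL2Inner g 0 u) (P.map_smul c v)).trans
      (covL2Inner_smul_right 0 c u (P v)))

lemma exists_extendsEnergy (hP : HasLeadingPart g k P) :
    ∃ B : Sobolev g k →L[ℝ] Sobolev g k →L[ℝ] ℝ, ExtendsEnergy P B := by
  obtain ⟨C, hC⟩ := Asymptotics.isBigO_top.1 (energy_isBigO g hP)
  obtain ⟨B, hB⟩ := exists_extension_bilinear ((energyForm g k P).mkContinuous₂ |C| fun u v => by
    have h := hC (u, v)
    rw [riemIntegral_mul] at h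
    rw [mul_assoc]
    refine h.trans ?_
    rw [Real.norm_eq_abs (sobolevProd g k k (u, v)), sobolevProd,
      abs_of_nonneg (mul_nonneg (sobolevNorm_nonneg g _ _) (sobolevNorm_nonneg g _ _))]
    exact mul_le_mul_of_nonneg_right (le_abs_self C)
      (mul_nonneg (sobolevNorm_nonneg g _ _) (sobolevNorm_nonneg g _ _)))
  refine ⟨B, fun u v => (hB u v).trans ?_⟩
  rw [riemIntegral_mul]
  rfl

/-- Two continuous functions of two variables in `H_k^2(M)` which agree on smooth functions are
equal. -/
lemma eq_of_eq_on_smooth {F G : Sobolev g k → Sobolev g k → ℝ}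
    (hF : Continuous fun X : Sobolev g k × Sobolev g k => F X.1 X.2)
    (hG : Continuous fun X : Sobolev g k × Sobolev g k => G X.1 X.2)
    (h : ∀ u v : SmoothFun n M, F (toSobolev u) (toSobolev v) = G (toSobolev u) (toSobolev v))
    (u v : Sobolev g k) : F u v = G u v :=
  congrFun (((dense_toSobolev (g := g) (k := k)).prodMap dense_toSobolev).equalizer hF hG
    (funext fun X => h X.1 X.2)) (u, v)

lemma symm_of_extendsEnergy (hP : IsL2SelfAdjoint g P)
    {B : Sobolev g k →L[ℝ] Sobolev g k →L[ℝ] ℝ} (hB : ExtendsEnergy P B) (u v : Sobolev g k) :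
    B u v = B v u := by
  refine eq_of_eq_on_smooth (F := fun u v => B u v) (G := fun u v => B v u)
    (by fun_prop) (by fun_prop) (fun u v => ?_) u v
  rw [hB, hB, hP]
  simp only [mul_comm]

/-- The Gårding inequality on `H_k^2(M)`, by density. -/
lemma exists_garding_sobolev (hk : 1 ≤ k) (hP : HasLeadingPart g k P)
    {B : Sobolev g k →L[ℝ] Sobolev g k →L[ℝ] ℝ} (hB : ExtendsEnergy P B) :
    ∃ c > 0, ∃ C, 0 ≤ C ∧ ∀ u : Sobolev g k,
      c * ‖u‖ ^ 2 ≤ B u u + C * sobolevL2Norm u ^ 2 := by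
  obtain ⟨c, hc, C, hC, h⟩ := exists_garding g hk hP
  refine ⟨c, hc, C, hC, fun u => ?_⟩
  have hl : Continuous (sobolevL2Norm : Sobolev g k → ℝ) := continuous_sobolevL2Norm
  refine (dense_toSobolev (g := g) (k := k)).induction_on u
    (isClosed_le (by fun_prop) (by fun_prop)) fun v => ?_
  rw [norm_toSobolev, sobolevL2Norm_toSobolev, hB]
  exact h v

/-- A coercive energy controls the norm of `H_k^2`: coercivity absorbs the `L²` term of the Gårding
inequality. -/
lemma exists_le_of_isCoerciveL2 (hk : 1 ≤ k) (hP : HasLeadingPart g k P)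
    {B : Sobolev g k →L[ℝ] Sobolev g k →L[ℝ] ℝ} (hB : ExtendsEnergy P B) (hB' : IsCoerciveL2 B) :
    ∃ c > 0, ∀ u : Sobolev g k, c * ‖u‖ ^ 2 ≤ B u u := by
  obtain ⟨c, hc, C, hC, h⟩ := exists_garding_sobolev hk hP hB
  obtain ⟨d, hd, h'⟩ := hB'
  refine ⟨c / (1 + C / d), by positivity, fun u => ?_⟩
  rw [div_mul_eq_mul_div, div_le_iff₀ (by positivity)]
  have h1 := mul_le_mul_of_nonneg_left (h' u) (div_nonneg hC hd.le)
  have h2 : C / d * (d * sobolevL2Norm u ^ 2) = C * sobolevL2Norm u ^ 2 := by field_simp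
  have := h u
  linarith

end Sobolev

end

end RiemSobolev

theorem proposition2p2 {n : ℕ} (hn : 3 ≤ n) {M : Type*} [TopologicalSpace M]
    [ChartedSpace (EuclSp n) M] [IsManifold (𝓡 n) ∞ M] [T2Space M] [CompactSpace M]
    (g : RiemMetric n M) (k : ℕ) (hk : 1 ≤ k) (hkn : Even n → 2 * k ≤ n)
    (P : SmoothFun n M →ₗ[ℝ] SmoothFun n M)
    (hP : RiemSobolev.HasLeadingPart g k P) (hP' : RiemSobolev.IsL2SelfAdjoint g P) :
    (∃! B : RiemSobolev.Sobolev g k →L[ℝ] RiemSobolev.Sobolev g k →L[ℝ] ℝ,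
      RiemSobolev.ExtendsEnergy P B) ∧
    ∀ B : RiemSobolev.Sobolev g k →L[ℝ] RiemSobolev.Sobolev g k →L[ℝ] ℝ,
      RiemSobolev.ExtendsEnergy P B →
        (∀ u v, B u v = B v u) ∧
        (RiemSobolev.IsCoerciveL2 B →
          RiemSobolev.IsNorm (fun u => √(B u u)) ∧
          RiemSobolev.AreEquivalent (fun u => √(B u u)) (fun u => ‖u‖)) := by
  refine ⟨?_, fun B hB => ⟨RiemSobolev.symm_of_extendsEnergy hP' hB, fun hc => ?_⟩⟩
  · obtain ⟨B, hB⟩ := RiemSobolev.exists_extendsEnergy hP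
    refine ⟨B, hB, fun B' hB' => ?_⟩
    ext u v
    exact RiemSobolev.eq_of_eq_on_smooth (F := fun u v => B' u v) (G := fun u v => B u v)
      (by fun_prop) (by fun_prop) (fun u v => by rw [hB u v, hB' u v]) u v
  -- The constant `√(‖B‖ + 1)` is positive even if `B = 0`, which happens when `M` is empty.
  · obtain ⟨c, hc0, h⟩ := RiemSobolev.exists_le_of_isCoerciveL2 hk hP hB hc
    have hnn : ∀ u, 0 ≤ B u u := fun u => le_trans (by positivity) (h u)
    refine ⟨RiemSobolev.isNorm_sqrt B.toLinearMap₁₂ (RiemSobolev.symm_of_extendsEnergy hP' hB) hnn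
      fun u hu => ?_, √c, Real.sqrt_pos.2 hc0, √(‖B‖ + 1), by positivity, fun u => ⟨?_, ?_⟩⟩
    · have h1 : B u u = 0 := hu
      have h2 := h u
      rw [h1] at h2
      have h3 : ‖u‖ ^ 2 = 0 := le_antisymm (nonpos_of_mul_nonpos_right h2 hc0) (sq_nonneg _)
      exact norm_eq_zero.1 (pow_eq_zero_iff two_ne_zero |>.1 h3)
    · refine Real.le_sqrt_of_sq_le ?_
      rw [mul_pow, Real.sq_sqrt hc0.le]
      exact h u
    · refine Real.sqrt_le_iff.2 ⟨by positivity, ?_⟩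
      rw [mul_pow, Real.sq_sqrt (by positivity)]
      have h1 := (le_abs_self _).trans (B.le_opNorm₂ u u)
      nlinarith [sq_nonneg ‖u‖]
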